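/- Let $N\ge 1$ be an integer, identified with $\{0,\dots,N-1\}$. **Creatures.** An FP creature (for the constant function $\mathbf H_N(n)=N$) is a tuple $t=(\mathrm{nor}[t],\mathrm{val}[t],\mathrm{dis}[t],m^t_{\rm dn},m^t_{\rm up})$, where $\mathrm{nor}[t]\ge 0$ is real, $\mathrm{dis}[t]$ is an arbitrary object, $m^t_{\rm dn}<m^t_{\rm up}$ are natural numbers, and $\mathrm{val}[t]$ is a nonempty finite set of nonempty finite functions $f$ with $\mathrm{dom}(f)\subseteq[m^t_{\rm dn},m^t_{\rm up})$ and values in $N$. Write $I_t=[m^t_{\rm dn},m^t_{\rm up})$. Let $K_N$ be the set of all FP creatures $t$ such that $\mathrm{dis}[t]=(X_t,\varphi_t)$ with $X_t\subsetneq I_t$ and $\varphi_t:X_t\to N$, $\mathrm{nor}[t]=m^t_{\rm up}$, and $$\mathrm{val}[t]=\{f: I_t\to N \;:\; \varphi_t\subseteq f \text{ and } f \text{ is constant on } I_t\setminus X_t\}.$$ For $t_0,\dots,t_n\in K_N$ with $m^{t_l}_{\rm up}=m^{t_{l+1}}_{\rm dn}$ for all $l<n$, let $\Sigma_N(t_0,\dots,t_n)$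 be the set of all $t\in K_N$ such that $m^t_{\rm dn}=m^{t_0}_{\rm dn}$, $m^t_{\rm up}=m^{t_n}_{\rm up}$, $X_{t_0}\cup\dots\cup X_{t_n}\subseteq X_t$, and for each $l\le n$ either (i) $X_t\cap I_{t_l}=X_{t_l}$ and $\varphi_t\restriction I_{t_l}=\varphi_{t_l}$, or (ii) $I_{t_l}\subseteq X_t$ and $\varphi_t\restriction I_{t_l}\in\mathrm{val}[t_l]$. **The space.** Let $\mathrm{PC}^{\tt tt}_\infty(K_N,\Sigma_N)$ be the set of tight pure candidates, i.e. of infinite sequences $\bar t=(t_0,t_1,\dots)$ of members of $K_N$ with $m^{t_n}_{\rm up}=m^{t_{n+1}}_{\rm dn}$ for all $n$ and $\lim_n\mathrm{nor}[t_n]=\infty$. Put $\bar t\le\bar s$ iff there is a strictly increasing sequence $(j_n)_{n<\omega}$ of natural numbers with $t_n\in\Sigma_N(s_{j_n},\dots,s_{j_{n+1}-1})$ for every $n$, and let $r_k(\bar t)=(t_i:i<k)$ for $k<\omega$. **Topological Ramsey spaces.** Let $\mathcal R$ be a nonempty set, $\le$ a quasi-ordering on $\mathcal R$, and $r_n$ ($n<\omega$)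 maps on $\mathcal R$. Put $[u,X]=\{Y\in\mathcal R: Y\le X\text{ and } r_n(Y)=u\text{ for some }n\}$; the Ellentuck topology is generated by all sets $[u,X]$. A set has the property of Baire if it is the symmetric difference of an open set and a meager set. A set $\mathcal X\subseteq\mathcal R$ is *Ramsey* (*Ramsey null*) if for every nonempty $[u,X]$ there is $Y\in[u,X]$ such that $[u,Y]\subseteq\mathcal X$ or $[u,Y]\cap\mathcal X=\emptyset$ (respectively such that $[u,Y]\cap\mathcal X=\emptyset$). The triple $(\mathcal R,\le,r)$ is a *topological Ramsey space* if, in the Ellentuck topology, every set with the property of Baire is Ramsey and every meager set is Ramsey null. **Theorem.** For every $N\ge1$, $\mathrm{PC}^{\tt tt}_\infty(K_N,\Sigma_N)$ is nonempty, $\le$ is a quasi-ordering on it, and $(\mathrm{PC}^{\tt tt}_\infty(K_N,\Sigma_N),\le,r)$ is a topological Ramsey space. The same holds if the inclusion $I_{t_l}\subseteq X_t$ in (ii) is replaced by the proper inclusion $I_{t_l}\subsetneq X_t$. -/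

import Mathlib

namespace TRS

/-! ### Topological Ramsey spaces -/

section Ramsey

variable {R A : Type*}

/-- The basic set `[u, X]`: all `Y ≤ X` having `u` among their finite approximations `r Y n`. -/
def basic (le : R → R → Prop) (r : R → ℕ → A) (u : A) (X : R) : Set R :=
  {Y | le Y X ∧ ∃ n, r Y n = u}

/-- The Ellentuck topology, generated by the sets `[u, X]`. -/
@[reducible]
def ellentuck (le : R → R → Prop) (r : R → ℕ → A) : TopologicalSpace R :=
  TopologicalSpace.generateFrom {S | ∃ u X, S = basic le r u X}

/-- The property of Baire: equal to an open set modulo a meager set. -/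
def HasBaireProperty (τ : TopologicalSpace R) (S : Set R) : Prop :=
  ∃ O M : Set R, @IsOpen R τ O ∧ @IsMeagre R τ M ∧ S = symmDiff O M

/-- Ramsey sets. -/
def IsRamsey (le : R → R → Prop) (r : R → ℕ → A) (S : Set R) : Prop :=
  ∀ (u : A) (X : R), (basic le r u X).Nonempty →
    ∃ Y ∈ basic le r u X, basic le r u Y ⊆ S ∨ basic le r u Y ∩ S = ∅

/-- Ramsey null sets. -/
def IsRamseyNull (le : R → R → Prop) (r : R → ℕ → A) (S : Set R) : Prop :=
  ∀ (u : A) (X : R), (basic le r u X).Nonempty →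
    ∃ Y ∈ basic le r u X, basic le r u Y ∩ S = ∅

/-- `(R, ≤, r)`, with `R` nonempty and `≤` a quasi-ordering, is a topological Ramsey space. -/
structure IsTopologicalRamseySpace (le : R → R → Prop) (r : R → ℕ → A) : Prop where
  nonempty : Nonempty R
  refl : ∀ X, le X X
  trans : ∀ X Y Z, le X Y → le Y Z → le X Z
  ramsey_of_baire : ∀ S : Set R, HasBaireProperty (ellentuck le r) S → IsRamsey le r S
  null_of_meager : ∀ S : Set R, @IsMeagre R (ellentuck le r) S → IsRamseyNull le r S

end Ramsey

/-! ### FP creatures and tight pure candidates -/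

section Creatures

/-- Partial functions `f` on `ℕ` with `f i ∈ H i`; `f i = none` means `i ∉ dom f`. -/
abbrev PFn (H : ℕ → Type) : Type := ∀ i, Option (H i)

variable {H : ℕ → Type} {D : Type}

/-- The domain of a partial function. -/
def PFn.dom (f : PFn H) : Set ℕ := {i | f i ≠ none}

open Classical in
/-- The restriction `f ↾ S`. -/
noncomputable def PFn.restrict (f : PFn H) (S : Set ℕ) : PFn H :=
  fun i => if i ∈ S then f i else none

/-- `f ⊆ g` as graphs. -/
def PFn.Extends (g f : PFn H) : Prop := ∀ i ∈ f.dom, g i = f i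

/-- FP creatures for `H`, with `dis` ranging over the type `D`. -/
@[ext]
structure FPCreature (H : ℕ → Type) (D : Type) where
  nor : NNReal
  val : Set (PFn H)
  dis : D
  mdn : ℕ
  mup : ℕ
  mdn_lt_mup : mdn < mup
  val_nonempty : val.Nonempty
  val_finite : val.Finite
  dom_nonempty : ∀ f ∈ val, f.dom.Nonempty
  dom_subset : ∀ f ∈ val, f.dom ⊆ Set.Ico mdn mup

/-- The interval `[m_dn, m_up)`. -/
def FPCreature.block (t : FPCreature H D) : Set ℕ := Set.Ico t.mdn t.mup

/-- The tight pure candidates `PC^tt_∞` over a set `K` of creatures. -/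
def PCtt (K : Set (FPCreature H D)) : Type :=
  {t : ℕ → FPCreature H D //
    (∀ n, t n ∈ K) ∧ (∀ n, (t n).mup = (t (n + 1)).mdn) ∧
      Filter.Tendsto (fun n => (t n).nor) Filter.atTop Filter.atTop}

/-- The finite sequence `(s_a, …, s_b)`, for `a ≤ b`. -/
def segment {α : Type} (s : ℕ → α) (a b : ℕ) : Fin (b - a + 1) → α := fun i => s (a + i)

/-- `t ≤ s` for a composition operation `Sig`: there is a strictly increasing `j` with
`t_n ∈ Sig (s_{j n}, …, s_{j (n+1) - 1})` for all `n`. -/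
def PCtt.le {K : Set (FPCreature H D)}
    (Sig : ∀ n : ℕ, (Fin (n + 1) → FPCreature H D) → Set (FPCreature H D))
    (t s : PCtt K) : Prop :=
  ∃ j : ℕ → ℕ, StrictMono j ∧
    ∀ n, t.1 n ∈ Sig _ (segment s.1 (j n) (j (n + 1) - 1))

/-- The restriction `r_k(t) = (t_0, …, t_{k-1})`. -/
def PCtt.r {K : Set (FPCreature H D)} (t : PCtt K) (k : ℕ) : List (FPCreature H D) :=
  (List.range k).map t.1

end Creatures

/-! ### The creating pair `(K_N, Σ_N)` -/

/-- Creatures for `H_N(n) = N` with `dis = (X, φ)`. -/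
abbrev CreatureN (N : ℕ) : Type :=
  FPCreature (fun _ => Fin N) (Set ℕ × PFn (fun _ => Fin N))

/-- The set `X_t`. -/
def CreatureN.X {N : ℕ} (t : CreatureN N) : Set ℕ := t.dis.1

/-- The function `φ_t`. -/
def CreatureN.phi {N : ℕ} (t : CreatureN N) : PFn (fun _ => Fin N) := t.dis.2

/-- The set of creatures `K_N`. -/
def KN (N : ℕ) : Set (CreatureN N) :=
  {t | CreatureN.X t ⊂ t.block ∧
    (CreatureN.phi t).dom = CreatureN.X t ∧
    t.nor = (t.mup : NNReal) ∧
    t.val = {f | f.dom = t.block ∧ f.Extends (CreatureN.phi t) ∧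
      ∀ i ∈ t.block \ CreatureN.X t, ∀ i' ∈ t.block \ CreatureN.X t, f i = f i'}}

/-- The operation `Σ_N`. The parameter `incl` is the inclusion relation (`⊆` or `⊂`) required between
a block on which the variable is substituted and `X_t`. -/
def SigmaN (N : ℕ) (incl : Set ℕ → Set ℕ → Prop) (n : ℕ) (s : Fin (n + 1) → CreatureN N) :
    Set (CreatureN N) :=
  {t | t ∈ KN N ∧ (∀ l, s l ∈ KN N) ∧
    (∀ l : Fin n, (s l.castSucc).mup = (s l.succ).mdn) ∧
    t.mdn = (s 0).mdn ∧ t.mup = (s (Fin.last n)).mup ∧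
    (⋃ l, CreatureN.X (s l)) ⊆ CreatureN.X t ∧
    ∀ l,
      (CreatureN.X t ∩ (s l).block = CreatureN.X (s l) ∧
        (CreatureN.phi t).restrict (s l).block = CreatureN.phi (s l)) ∨
      (incl (s l).block (CreatureN.X t) ∧
        (CreatureN.phi t).restrict (s l).block ∈ (s l).val)}

end TRS

/-! The proof splits into an abstract Ellentuck theorem and a Ramsey statement for single creatures.
On the abstract side, Todorcevic-style conditions (finitely many approximations ending at a given
place, amalgamation, limits of fusion sequences, and a pigeonhole principle for one-step extensions)
suffice. Combinatorial forcing (`exists_cone_of_isOpen`) settles open sets, and fusion against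
countably many dense open sets (`exists_cone_of_isMeagre`) makes meager sets Ramsey null; sets with
the property of Baire follow.

On the creature side, composing consecutive creatures means choosing for each block either a
constant to substitute or to leave it variable, with at least one block left variable. Compositions
are thus coded by variable words over the alphabet `Fin N`, and compositions of compositions by
substitution. Carlson's theorem (`exists_carlson`), proved with idempotent ultrafilters, therefore
gives the pigeonhole principle. The version with proper inclusion needs each substituted block to be
accompanied by another point of `X_t`; this is arranged by using words with two constant letters, so
one argument serves both versions. -/

namespace TRS

/-! ### An abstract Ellentuck theorem -/

section Abstract

variable {R A : Type*}

/-- Conditions on `(R, ≤, r)` sufficient for it to be a topological Ramsey space. The function `e`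
locates the end of a finite approximation; it plays the role of the depth function. -/
structure EllentuckConditions (le : R → R → Prop) (r : R → ℕ → A) (e : A → ℕ) : Prop where
  nonempty : Nonempty R
  refl : ∀ X, le X X
  trans : ∀ X Y Z, le X Y → le Y Z → le X Z
  length_eq : ∀ X Y m n, r X m = r Y n → m = n
  restrict : ∀ X Y m n, m ≤ n → r X n = r Y n → r X m = r Y m
  strictMono : ∀ X, StrictMono fun n => e (r X n)
  depth : ∀ X Y, le Y X → ∀ m, ∃ d, e (r Y m) = e (r X d)
  finite : ∀ k, {u | e u = k ∧ ∃ X n, r X n = u}.Finite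
  limit : ∀ (n : ℕ) (Y : ℕ → R),
    (∀ k, le (Y (k + 1)) (Y k) ∧ r (Y (k + 1)) (n + k) = r (Y k) (n + k)) →
    ∃ Z, ∀ k, le Z (Y k) ∧ r Z (n + k) = r (Y k) (n + k)
  amalgamation : ∀ X Y Z m d, le Y X → e (r Y m) = e (r X d) → le Z Y → r Z m = r Y m →
    ∃ X', le X' X ∧ r X' d = r X d ∧ ∀ W, le W X' → r W m = r Y m → le W Z
  pigeonhole : ∀ X n (O : Set A), ∃ Y, le Y X ∧ r Y n = r X n ∧
    ((∀ Z, le Z Y → r Z n = r X n → r Z (n + 1) ∈ O) ∨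
      ∀ Z, le Z Y → r Z n = r X n → r Z (n + 1) ∉ O)

/-- The elements below `X` with the same approximation of length `n` as `X`. -/
def cone (le : R → R → Prop) (r : R → ℕ → A) (n : ℕ) (X : R) : Set R :=
  {Y | le Y X ∧ r Y n = r X n}

namespace EllentuckConditions

variable {le : R → R → Prop} {r : R → ℕ → A} {e : A → ℕ}

theorem basic_eq_cone (h : EllentuckConditions le r e) (n : ℕ) (X : R) :
    basic le r (r X n) X = cone le r n X := by
  ext Y
  constructor
  · rintro ⟨h1, m, hm⟩
    obtain rfl := h.length_eq _ _ _ _ hm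
    exact ⟨h1, hm⟩
  · rintro ⟨h1, h2⟩
    exact ⟨h1, n, h2⟩

theorem self_mem_cone (h : EllentuckConditions le r e) (n : ℕ) (X : R) : X ∈ cone le r n X :=
  ⟨h.refl X, rfl⟩

theorem cone_subset (h : EllentuckConditions le r e) {m n : ℕ} (hmn : m ≤ n) {X Y : R}
    (hY : Y ∈ cone le r m X) : cone le r n Y ⊆ cone le r m X := fun _ hZ =>
  ⟨h.trans _ _ _ hZ.1 hY.1, (h.restrict _ _ _ _ hmn hZ.2).trans hY.2⟩

/-- The approximations in `U` are treated one at a time. If `u` is realized by some `W` below the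
current element, density at `W` gives a witness `V`, and amalgamation shrinks the element, keeping
its first `d` terms, until everything below it through `u` lies below `V`. Earlier instances survive
because `P` is inherited by subsets. -/
theorem fusion_finite (h : EllentuckConditions le r e) {P : A → Set R → Prop}
    (hP : ∀ u B B', B' ⊆ B → P u B → P u B') {n : ℕ} {X₀ : R}
    (hd : ∀ X ∈ cone le r n X₀, ∀ m, n ≤ m → ∃ Y ∈ cone le r m X, P (r X m) (basic le r (r X m) Y))
    {X : R} (hX : X ∈ cone le r n X₀) {d : ℕ} (hnd : n ≤ d) {U : Set A} (hU : U.Finite) :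
    ∃ X' ∈ cone le r d X, ∀ u ∈ U, e u = e (r X d) →
      ∀ Z ∈ cone le r n X', ∀ m, n ≤ m → r Z m = u → P u (basic le r u X') := by
  induction U, hU using Set.Finite.induction_on with
  | empty => exact ⟨X, h.self_mem_cone d X, by simp⟩
  | @insert u U _ _ ih =>
    obtain ⟨X', hX', hP'⟩ := ih
    by_cases hu : e u = e (r X d) ∧ ∃ W ∈ cone le r n X', ∃ m, n ≤ m ∧ r W m = u
    · obtain ⟨heu, W, hW, m, hnm, rfl⟩ := hu
      have hX'0 : X' ∈ cone le r n X₀ := h.cone_subset hnd hX hX'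
      obtain ⟨V, hV, hPV⟩ := hd W (h.cone_subset le_rfl hX'0 hW) m hnm
      obtain ⟨X'', h1, h2, h3⟩ := h.amalgamation X' W V m d hW.1 (heu.trans (by rw [hX'.2]))
        hV.1 hV.2
      have hX'' : X'' ∈ cone le r d X' := ⟨h1, h2⟩
      refine ⟨X'', h.cone_subset le_rfl hX' hX'', ?_⟩
      intro v hv hev Z hZ k hnk hk
      rcases Set.mem_insert_iff.1 hv with rfl | hv
      · refine hP _ _ _ ?_ hPV
        rintro Y ⟨hY, l, hl⟩
        obtain rfl := h.length_eq _ _ _ _ hl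
        exact ⟨h3 Y hY hl, l, hl⟩
      · refine hP _ _ _ ?_ (hP' v hv hev Z ?_ k hnk hk)
        · rintro Y ⟨hY, hl⟩
          exact ⟨h.trans _ _ _ hY h1, hl⟩
        · exact h.cone_subset le_rfl ⟨h1, h.restrict _ _ _ _ hnd h2⟩ hZ
    · refine ⟨X', hX', ?_⟩
      intro v hv hev Z hZ k hnk hk
      rcases Set.mem_insert_iff.1 hv with rfl | hv
      · exact absurd ⟨hev, Z, hZ, k, hnk, hk⟩ hu
      · exact hP' v hv hev Z hZ k hnk hk

/-- Stage `k` handles the finitely many approximations ending where `r X (n + k)` ends and freezes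
those `n + k` terms. Every approximation of length at least `n` in the cone of the limit ends where
one of the frozen ones does, so it was handled at some stage. -/
theorem fusion (h : EllentuckConditions le r e) {P : A → Set R → Prop}
    (hP : ∀ u B B', B' ⊆ B → P u B → P u B') {n : ℕ} {X₀ : R}
    (hd : ∀ X ∈ cone le r n X₀, ∀ m, n ≤ m →
      ∃ Y ∈ cone le r m X, P (r X m) (basic le r (r X m) Y)) :
    ∃ Y ∈ cone le r n X₀, ∀ Z ∈ cone le r n Y, ∀ m, n ≤ m → P (r Z m) (basic le r (r Z m) Y) := by
  have step : ∀ (k : ℕ) (X : cone le r n X₀), ∃ X' : cone le r n X₀,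
      X'.1 ∈ cone le r (n + k) X.1 ∧ ∀ u, e u = e (r X.1 (n + k)) →
      ∀ Z ∈ cone le r n X'.1, ∀ m, n ≤ m → r Z m = u → P u (basic le r u X'.1) := by
    rintro k ⟨X, hX⟩
    obtain ⟨X', hX', hP'⟩ := h.fusion_finite hP hd hX (Nat.le_add_right n k)
      (h.finite (e (r X (n + k))))
    exact ⟨⟨X', h.cone_subset (Nat.le_add_right n k) hX hX'⟩, hX',
      fun u hu Z hZ m hm hr => hP' u ⟨hu, Z, m, hr⟩ hu Z hZ m hm hr⟩
  choose F hF1 hF2 using step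
  let Y : ℕ → cone le r n X₀ := fun k => Nat.rec ⟨X₀, h.self_mem_cone n X₀⟩ F k
  obtain ⟨L, hL⟩ := h.limit n (fun k => (Y k).1) (fun k => hF1 k (Y k))
  have hL0 : L ∈ cone le r n X₀ := hL 0
  refine ⟨L, hL0, ?_⟩
  intro Z hZ m hnm
  obtain ⟨d, hde⟩ := h.depth L Z hZ.1 m
  have hnd : n ≤ d := by
    by_contra hlt
    have h1 : e (r L d) < e (r L n) := h.strictMono L (not_le.1 hlt)
    have h2 : e (r Z n) ≤ e (r Z m) := (h.strictMono Z).monotone hnm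
    rw [hZ.2] at h2
    omega
  obtain ⟨k, rfl⟩ := Nat.exists_eq_add_of_le hnd
  have hLn : L ∈ cone le r n (Y (k + 1)).1 :=
    ⟨(hL (k + 1)).1, h.restrict _ _ _ _ (Nat.le_add_right _ _) (hL (k + 1)).2⟩
  have := hF2 k (Y k) (r Z m) (by rw [hde, (hL k).2]) Z (h.cone_subset le_rfl hLn hZ) m hnm rfl
  refine hP _ _ _ ?_ this
  rintro W ⟨hW, hl⟩
  exact ⟨h.trans _ _ _ hW hLn.1, hl⟩

/-! ### Open and meager sets in the Ellentuck topology -/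

theorem isOpen_cone (h : EllentuckConditions le r e) (n : ℕ) (X : R) :
    @IsOpen R (ellentuck le r) (cone le r n X) := by
  rw [← h.basic_eq_cone]
  exact TopologicalSpace.isOpen_generateFrom_of_mem ⟨_, _, rfl⟩

theorem exists_cone_subset (h : EllentuckConditions le r e) {S : Set R}
    (hS : @IsOpen R (ellentuck le r) S) : ∀ X ∈ S, ∃ n, cone le r n X ⊆ S := by
  have hS' : TopologicalSpace.GenerateOpen {S | ∃ u X, S = basic le r u X} S := hS
  induction hS' with
  | basic s hs =>
    obtain ⟨u, Z, rfl⟩ := hs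
    rintro X ⟨hX, n, hn⟩
    exact ⟨n, fun Y hY => ⟨h.trans _ _ _ hY.1 hX, n, hY.2.trans hn⟩⟩
  | univ => exact fun X _ => ⟨0, Set.subset_univ _⟩
  | inter s t hs ht ihs iht =>
    rintro X ⟨hXs, hXt⟩
    obtain ⟨m, hm⟩ := ihs hs X hXs
    obtain ⟨n, hn⟩ := iht ht X hXt
    exact ⟨max m n, Set.subset_inter
      ((h.cone_subset (le_max_left m n) (h.self_mem_cone _ X)).trans hm)
      ((h.cone_subset (le_max_right m n) (h.self_mem_cone _ X)).trans hn)⟩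
  | sUnion T hT ih =>
    rintro X ⟨s, hs, hX⟩
    obtain ⟨n, hn⟩ := ih s hs (hT s hs) X hX
    exact ⟨n, hn.trans (Set.subset_sUnion_of_mem hs)⟩

/-- Combinatorial forcing. A first fusion yields `Y` deciding every approximation `u`: either `[u,
Y] ⊆ S` (accepted), or no member of `[u, Y]` accepts `u` (rejected). If the stem is rejected, a
second fusion, by the pigeonhole principle, makes rejection pass to all one-step extensions. A point
of the open set `S` has a cone inside `S`, which contradicts rejection of its long approximations.
-/
theorem exists_cone_of_isOpen (h : EllentuckConditions le r e) {S : Set R}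
    (hS : @IsOpen R (ellentuck le r) S) (n : ℕ) (X : R) :
    ∃ Y ∈ cone le r n X, cone le r n Y ⊆ S ∨ Disjoint (cone le r n Y) S := by
  obtain ⟨Y, hYX, hY⟩ := h.fusion (n := n) (X₀ := X)
    (P := fun u B => B ⊆ S ∨ ∀ Y ∈ B, ¬ basic le r u Y ⊆ S)
    (by
      rintro u B B' hB (h1 | h1)
      · exact Or.inl (hB.trans h1)
      · exact Or.inr fun Y hY => h1 Y (hB hY))
    (by
      intro X _ m _
      by_cases hex : ∃ Y ∈ cone le r m X, basic le r (r X m) Y ⊆ S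
      · obtain ⟨Y, hY, hYS⟩ := hex
        exact ⟨Y, hY, Or.inl hYS⟩
      · refine ⟨X, h.self_mem_cone _ _, Or.inr fun Y hY hYS => hex ⟨Y, ?_, hYS⟩⟩
        rwa [h.basic_eq_cone] at hY)
  by_cases hacc : basic le r (r Y n) Y ⊆ S
  · exact ⟨Y, hYX, Or.inl (by rwa [h.basic_eq_cone] at hacc)⟩
  obtain ⟨Y', hY'Y, hY'⟩ := h.fusion (n := n) (X₀ := Y)
    (P := fun u B => basic le r u Y ⊆ S ∨
      ∀ Z ∈ B, ∀ m, r Z m = u → ¬ basic le r (r Z (m + 1)) Y ⊆ S)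
    (by
      rintro u B B' hB (h1 | h1)
      · exact Or.inl h1
      · exact Or.inr fun Y hY => h1 Y (hB hY))
    (by
      intro X hX m hm
      rcases hY X hX m hm with h1 | h1
      · exact ⟨X, h.self_mem_cone _ _, Or.inl h1⟩
      obtain ⟨X', hX'1, hX'2, hX'3 | hX'3⟩ :=
        h.pigeonhole X m {v | basic le r v Y ⊆ S}
      -- If all one-step extensions below `X'` were accepted, `X'` itself would accept `r X m`,
      -- which is rejected.
      · have hX'Y : le X' Y := h.trans _ _ _ hX'1 hX.1
        refine absurd ?_ (h1 X' ⟨hX'Y, m, hX'2⟩)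
        rintro Z ⟨hZ, l, hl⟩
        obtain rfl := h.length_eq _ _ _ _ hl
        exact hX'3 Z hZ hl ⟨h.trans _ _ _ hZ hX'Y, _, rfl⟩
      · refine ⟨X', ⟨hX'1, hX'2⟩, Or.inr ?_⟩
        rintro Z ⟨hZ, -⟩ l hl
        obtain rfl := h.length_eq _ _ _ _ hl
        exact hX'3 Z hZ hl)
  have hrej : ∀ k, ∀ Z ∈ cone le r n Y', ¬ basic le r (r Z (n + k)) Y ⊆ S := by
    intro k
    induction k with
    | zero =>
      intro Z hZ
      rwa [Nat.add_zero, hZ.2, hY'Y.2]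
    | succ k ih =>
      intro Z hZ
      rcases hY' Z hZ (n + k) (Nat.le_add_right _ _) with h1 | h1
      · exact absurd h1 (ih Z hZ)
      · exact h1 Z ⟨hZ.1, _, rfl⟩ (n + k) rfl
  refine ⟨Y', h.cone_subset le_rfl hYX hY'Y, Or.inr ?_⟩
  rw [Set.disjoint_left]
  intro Z hZ hZS
  obtain ⟨m, hm⟩ := h.exists_cone_subset hS Z hZS
  have hZY : Z ∈ cone le r n Y := h.cone_subset le_rfl hY'Y hZ
  rcases hY Z hZY (n + m) (Nat.le_add_right _ _) with h1 | h1
  · exact hrej m Z hZ h1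
  · refine h1 Z ⟨hZY.1, _, rfl⟩ ?_
    rw [h.basic_eq_cone]
    exact (h.cone_subset (Nat.le_add_left m n) (h.self_mem_cone _ _)).trans hm

/-- The complement contains a countable intersection of dense open sets `O i`. Fusion puts `[u, Y]`
inside the first `e u` of them; the disjoint alternative for open sets is excluded by density. Since
`e` is unbounded along approximations, the resulting cone lies in every `O i`. -/
theorem exists_cone_of_isMeagre (h : EllentuckConditions le r e) {S : Set R}
    (hS : @IsMeagre R (ellentuck le r) S) (n : ℕ) (X : R) :
    ∃ Y ∈ cone le r n X, Disjoint (cone le r n Y) S := by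
  let := ellentuck le r
  obtain ⟨T, hTo, hTd, hTc, hTS⟩ := mem_residual_iff.1 hS
  -- Adding `univ` keeps the family nonempty, so that it can be enumerated.
  obtain ⟨O, hO⟩ := (hTc.insert Set.univ).exists_eq_range (Set.insert_nonempty _ _)
  have hO' : ∀ k, IsOpen (O k) ∧ Dense (O k) := by
    intro k
    have : O k ∈ insert Set.univ T := hO ▸ Set.mem_range_self k
    rcases this with h1 | h1
    · rw [h1]; exact ⟨isOpen_univ, dense_univ⟩
    · exact ⟨hTo _ h1, hTd _ h1⟩
  have hI : ∀ k, IsOpen (⋂ i ∈ Set.Iio k, O i) ∧ Dense (⋂ i ∈ Set.Iio k, O i) := by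
    intro k
    induction k with
    | zero => simp
    | succ k ih =>
      have : (⋂ i ∈ Set.Iio (k + 1), O i) = (⋂ i ∈ Set.Iio k, O i) ∩ O k := by
        ext x
        simp only [Set.mem_iInter, Set.mem_Iio, Set.mem_inter_iff]
        constructor
        · exact fun hx => ⟨fun i hi => hx i (by omega), hx k (by omega)⟩
        · rintro ⟨h1, h2⟩ i hi
          rcases Nat.lt_succ_iff_lt_or_eq.1 hi with h3 | rfl
          · exact h1 i h3
          · exact h2
      rw [this]
      exact ⟨ih.1.inter (hO' k).1, ih.2.inter_of_isOpen_left (hO' k).2 ih.1⟩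
  obtain ⟨Y, hYX, hY⟩ := h.fusion (n := n) (X₀ := X)
    (P := fun u B => B ⊆ ⋂ i ∈ Set.Iio (e u), O i)
    (fun u B B' hB h1 => hB.trans h1)
    (by
      intro X _ m _
      obtain ⟨Y, hY, h1 | h1⟩ := h.exists_cone_of_isOpen (hI (e (r X m))).1 m X
      · refine ⟨Y, hY, ?_⟩
        rwa [← hY.2, h.basic_eq_cone, hY.2]
      · obtain ⟨Z, hZ, hZ'⟩ := (hI (e (r X m))).2.inter_open_nonempty _ (h.isOpen_cone m Y)
          ⟨Y, h.self_mem_cone m Y⟩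
        exact absurd hZ' (Set.disjoint_left.1 h1 hZ))
  refine ⟨Y, hYX, ?_⟩
  rw [Set.disjoint_left]
  intro Z hZ hZS
  refine absurd hZS (hTS ?_)
  intro s hs
  obtain ⟨k, rfl⟩ : s ∈ Set.range O := hO ▸ Set.mem_insert_of_mem _ hs
  have h1 := hY Z hZ (n + (k + 1)) (Nat.le_add_right _ _) ⟨hZ.1, _, rfl⟩
  refine Set.mem_iInter₂.1 h1 k ?_
  have := (h.strictMono Z).le_apply (x := n + (k + 1))
  simp only [Set.mem_Iio]
  omega

theorem exists_mem_basic {p : Set R → Prop} (h : EllentuckConditions le r e)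
    (hS : ∀ n X, ∃ Y ∈ cone le r n X, p (cone le r n Y)) (u : A) (X : R)
    (hu : (basic le r u X).Nonempty) : ∃ Y ∈ basic le r u X, p (basic le r u Y) := by
  obtain ⟨Z, hZ, n, rfl⟩ := hu
  obtain ⟨Y, hY, hp⟩ := hS n Z
  refine ⟨Y, ⟨h.trans _ _ _ hY.1 hZ, n, hY.2⟩, ?_⟩
  rwa [← hY.2, h.basic_eq_cone]

theorem isTopologicalRamseySpace (h : EllentuckConditions le r e) : IsTopologicalRamseySpace le r where
  nonempty := h.nonempty
  refl := h.refl
  trans := h.trans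
  ramsey_of_baire := by
    rintro S ⟨O, M, hO, hM, rfl⟩
    refine h.exists_mem_basic
      (p := fun B => B ⊆ symmDiff O M ∨ B ∩ symmDiff O M = ∅) fun n X => ?_
    obtain ⟨Y, hY, hYM⟩ := h.exists_cone_of_isMeagre hM n X
    obtain ⟨Z, hZ, hZO⟩ := h.exists_cone_of_isOpen hO n Y
    have hZM := hYM.mono_left (h.cone_subset le_rfl hZ)
    refine ⟨Z, h.cone_subset le_rfl hY hZ, hZO.imp ?_ ?_⟩
    · exact fun h1 W hW => Or.inl ⟨h1 hW, Set.disjoint_left.1 hZM hW⟩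
    · intro h1
      rw [Set.eq_empty_iff_forall_notMem]
      rintro W ⟨hW, h2 | h2⟩
      · exact Set.disjoint_left.1 h1 hW h2.1
      · exact Set.disjoint_left.1 hZM hW h2.1
  null_of_meager := by
    intro S hS
    exact h.exists_mem_basic (p := fun B => B ∩ S = ∅) fun n X => by
      simpa only [Set.disjoint_iff_inter_eq_empty] using h.exists_cone_of_isMeagre hS n X

end EllentuckConditions

end Abstract

end TRS

namespace TRS

/-! ### Carlson's theorem on variable words -/

section Carlson

open Filter

attribute [local instance] Ultrafilter.mul Ultrafilter.semigroup

/-- An idempotent `w` of a minimal closed left ideal `J` works: if `q` is below `w`, then `M q` is a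
closed left ideal inside `J`, hence equal to `J`, so `w = m q` and `q = w q = m q q = w`. -/
theorem exists_minimal_idempotent {M : Type*} [Nonempty M] [Semigroup M] [TopologicalSpace M]
    [CompactSpace M] [T2Space M] (hc : ∀ r : M, Continuous (· * r)) :
    ∃ w : M, w * w = w ∧ ∀ q, q * q = q → q * w = q → w * q = q → q = w := by
  let S : Set (Set M) := {J | IsClosed J ∧ J.Nonempty ∧ ∀ m, ∀ x ∈ J, m * x ∈ J}
  obtain ⟨J, hJ⟩ : ∃ J, Minimal (· ∈ S) J := by
    refine zorn_superset _ fun c hcs hcc => ?_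
    refine ⟨⋂₀ c, ⟨isClosed_sInter fun t ht => (hcs ht).1, ?_,
      fun m x hx t ht => (hcs ht).2.2 m x (hx t ht)⟩, fun s hs => Set.sInter_subset_of_mem hs⟩
    obtain rfl | hne := c.eq_empty_or_nonempty
    · rw [Set.sInter_empty]
      exact Set.univ_nonempty
    · have := hne.to_subtype
      rw [Set.sInter_eq_iInter]
      exact IsCompact.nonempty_iInter_of_directed_nonempty_isCompact_isClosed _
        (DirectedOn.directed_val (IsChain.directedOn hcc.symm))
        (fun i => (hcs i.2).2.1) (fun i => (hcs i.2).1.isCompact) fun i => (hcs i.2).1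
  obtain ⟨hJc, hJn, hJm⟩ := hJ.prop
  obtain ⟨w, hwJ, hw⟩ := exists_idempotent_in_compact_subsemigroup hc J hJn hJc.isCompact
    fun x _ y hy => hJm x y hy
  refine ⟨w, hw, fun q hqq hqw hwq => ?_⟩
  have hsub : Set.range (· * q) ⊆ J := by
    rintro _ ⟨m, rfl⟩
    exact hJm _ _ (hqw ▸ hJm q w hwJ)
  have heq : Set.range (· * q) = J := by
    refine hJ.eq_of_subset ⟨(isCompact_range (hc q)).isClosed, Set.range_nonempty _, ?_⟩ hsub
    rintro m _ ⟨x, rfl⟩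
    exact ⟨m * x, mul_assoc _ _ _⟩
  obtain ⟨m, hm⟩ : w ∈ Set.range (· * q) := heq ▸ hwJ
  have hm' : m * q = w := hm
  rw [← hwq, ← hm', mul_assoc, hqq]

theorem ultrafilter_map_mul {M M' : Type*} [Mul M] [Mul M'] (f : M →ₙ* M') (U V : Ultrafilter M) :
    (U * V).map f = U.map f * V.map f := by
  refine Ultrafilter.coe_inj.mp (Filter.ext' fun p => ?_)
  have h1 : (∀ᶠ x in ((U * V).map f : Filter M'), p x) ↔
      ∀ᶠ m in (U : Filter M), ∀ᶠ m' in (V : Filter M), p (f (m * m')) := Iff.rfl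
  have h2 : (∀ᶠ x in (U.map f * V.map f : Ultrafilter M'), p x) ↔
      ∀ᶠ m in (U : Filter M), ∀ᶠ m' in (V : Filter M), p (f m * f m') := Iff.rfl
  rw [h1, h2]
  simp only [map_mul]

variable {α : Type*}

/-- Substitute `b` for the variable in the word `y`, where `none` is the variable. -/
def subst (b : Option α) (y : List (Option α)) : List (Option α) := y.map (·.or b)

theorem subst_append (b : Option α) (y z : List (Option α)) :
    subst b (y ++ z) = subst b y ++ subst b z := List.map_append

theorem subst_none (y : List (Option α)) : subst none y = y := by
  simp [subst]

theorem none_notMem_subst (a : α) (y : List (Option α)) : none ∉ subst (some a) y := by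
  simp [subst]

theorem length_subst (b : Option α) (y : List (Option α)) : (subst b y).length = y.length := by
  simp [subst]

/-- Take `w` minimal among idempotents on constant words and `u ≤ w` idempotent on variable words.
Substituting a letter is a homomorphism fixing constant words, so it sends `u` to an idempotent
below `w`, which is `w` by minimality. -/
theorem exists_variable_ultrafilter (α : Type*) :
    ∃ u w : Ultrafilter (FreeMonoid (Option α)), u * u = u ∧ w * w = w ∧ u * w = u ∧ w * u = u ∧
      (∀ᶠ y in (u : Filter (FreeMonoid (Option α))), none ∈ FreeMonoid.toList y) ∧
      ∀ a : α, u.map (fun y => FreeMonoid.ofList (subst (some a) (FreeMonoid.toList y))) = w := by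
  obtain ⟨w₀, hw₀, hmin⟩ :=
    exists_minimal_idempotent (Ultrafilter.continuous_mul_left (M := FreeMonoid α))
  let i : FreeMonoid α →* FreeMonoid (Option α) := FreeMonoid.map some
  let T : α → FreeMonoid (Option α) →* FreeMonoid α := fun a => FreeMonoid.map (·.getD a)
  have hTi : ∀ a, T a ∘ i = id := by
    intro a
    funext x
    change List.map _ (List.map _ x.toList) = x.toList
    simp
  set w := w₀.map (i : FreeMonoid α →ₙ* FreeMonoid (Option α)) with hwdef
  have hw : w * w = w := by rw [hwdef, ← ultrafilter_map_mul, hw₀]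
  have hTw : ∀ a, w.map (T a : FreeMonoid (Option α) →ₙ* FreeMonoid α) = w₀ := by
    intro a
    rw [hwdef, Ultrafilter.map_map]
    exact (congrArg (fun f => Ultrafilter.map f w₀) (hTi a)).trans (Ultrafilter.map_id w₀)
  let V : Set (FreeMonoid (Option α)) := {y | none ∈ FreeMonoid.toList y}
  have hVl : ∀ x y, y ∈ V → x * y ∈ V := fun x y hy => List.mem_append_right _ hy
  have hVr : ∀ x y, x ∈ V → x * y ∈ V := fun x y hy => List.mem_append_left _ hy
  have hmemr : ∀ p q : Ultrafilter (FreeMonoid (Option α)), V ∈ p → V ∈ p * q := by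
    intro p q hp
    change ∀ᶠ m in ↑(p * q), m ∈ V
    rw [Ultrafilter.eventually_mul]
    filter_upwards [hp] with x hx
    exact Eventually.of_forall fun y => hVr x y hx
  have hmeml : ∀ p q : Ultrafilter (FreeMonoid (Option α)), V ∈ q → V ∈ p * q := by
    intro p q hq
    change ∀ᶠ m in ↑(p * q), m ∈ V
    rw [Ultrafilter.eventually_mul]
    refine Eventually.of_forall fun x => ?_
    filter_upwards [hq] with y hy
    exact hVl x y hy
  -- This set is a compact subsemigroup whose idempotents satisfy `u₀ * w = u₀`. Multiplying by `w`
  -- on the left then gives absorption on both sides.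
  have hcomp : IsCompact ((· * w) '' {p : Ultrafilter (FreeMonoid (Option α)) | V ∈ p}) :=
    (ultrafilter_isClosed_basic V).isCompact.image (Ultrafilter.continuous_mul_left w)
  obtain ⟨u₀, ⟨p, hp, hpu⟩, hu₀⟩ := exists_idempotent_in_compact_subsemigroup
    (Ultrafilter.continuous_mul_left (M := FreeMonoid (Option α))) _
    (by
      refine ⟨_, pure (FreeMonoid.of none), ?_, rfl⟩
      change V ∈ (pure (FreeMonoid.of none) : Ultrafilter _)
      rw [Ultrafilter.mem_pure]
      exact List.mem_singleton_self _) hcomp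
    (by
      rintro _ ⟨p, hp, rfl⟩ _ ⟨q, hq, rfl⟩
      exact ⟨p * w * q, hmeml (p * w) q hq, mul_assoc _ _ _⟩)
  have hpu' : p * w = u₀ := hpu
  have hu₀w : u₀ * w = u₀ := by rw [← hpu', mul_assoc, hw]
  have huu : (w * u₀) * (w * u₀) = w * u₀ := by
    rw [mul_assoc, ← mul_assoc u₀, hu₀w, hu₀]
  have huw : (w * u₀) * w = w * u₀ := by rw [mul_assoc, hu₀w]
  have hwu : w * (w * u₀) = w * u₀ := by rw [← mul_assoc, hw]
  refine ⟨w * u₀, w, huu, hw, huw, hwu, hmeml _ _ (hpu' ▸ hmemr _ _ hp), fun a => ?_⟩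
  have hT : (w * u₀).map (T a : FreeMonoid (Option α) →ₙ* FreeMonoid α) = w₀ := by
    refine hmin _ ?_ ?_ ?_
    · rw [← ultrafilter_map_mul, huu]
    · conv_lhs => rw [← hTw a]
      rw [← ultrafilter_map_mul, huw]
    · conv_lhs => rw [← hTw a]
      rw [← ultrafilter_map_mul, hwu]
  conv_rhs => rw [hwdef, ← hT, Ultrafilter.map_map]
  congr 1
  funext y
  change List.map _ y.toList = List.map some (List.map _ y.toList)
  rw [List.map_map]
  refine List.map_congr_left fun x _ => ?_
  cases x <;> rfl

/-- The word `y₀[v₀] y₁[v₁] ⋯`. -/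
def extract (y : ℕ → List (Option α)) (v : List (Option α)) : List (Option α) :=
  (v.zipIdx.map fun b => subst b.1 (y b.2)).flatten

theorem extract_nil (y : ℕ → List (Option α)) : extract y [] = [] := rfl

theorem extract_concat (y : ℕ → List (Option α)) (v : List (Option α)) (b : Option α) :
    extract y (v ++ [b]) = extract y v ++ subst b (y v.length) := by
  simp [extract, List.zipIdx_append]

/-- A prefix is good if `u`-almost every continuation lies in `A` and, once it contains the
variable, it lies in `A` itself together with `w`-almost every continuation. The relations `uu = uw
= wu = u` and `ww = w` make goodness persist for `u`-almost every extension, since `y` with a letter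
substituted is distributed as `w`. -/
theorem exists_good_words [Finite α] (A : Set (List (Option α))) :
    ∃ G : Set (List (Option α)), [] ∈ G ∧
      ((∀ p ∈ G, none ∈ p → p ∈ A) ∨ (∀ p ∈ G, none ∈ p → p ∉ A)) ∧
      ∀ F ⊆ G, F.Finite → ∃ y, none ∈ y ∧ ∀ p ∈ F, ∀ b, p ++ subst b y ∈ G := by
  obtain ⟨u, w, huu, hww, huw, hwu, huV, hsub⟩ := exists_variable_ultrafilter α
  wlog hA : A ∈ u.map FreeMonoid.toList generalizing A
  · obtain ⟨G, h1, h2, h3⟩ := this Aᶜ (Ultrafilter.compl_mem_iff_notMem.2 hA)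
    refine ⟨G, h1, ?_, h3⟩
    rcases h2 with h2 | h2
    · exact Or.inr h2
    · exact Or.inl fun p hp hn => not_not.1 (h2 p hp hn)
  let u' : Filter (List (Option α)) := u.map FreeMonoid.toList
  let w' : Filter (List (Option α)) := w.map FreeMonoid.toList
  have em : ∀ (p q : Ultrafilter (FreeMonoid (Option α))) (P : List (Option α) → Prop),
      (∀ᶠ x in ((p * q).map FreeMonoid.toList : Filter _), P x) →
      ∀ᶠ y in (p.map FreeMonoid.toList : Filter _), ∀ᶠ x in (q.map FreeMonoid.toList : Filter _),
        P (y ++ x) := by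
    intro p q P hP
    have := (Ultrafilter.eventually_mul p q fun x => P x.toList).1 hP
    simp only [FreeMonoid.toList_mul] at this
    exact this
  have eu : ∀ P : List (Option α) → Prop, (∀ᶠ x in u', P x) →
      (∀ᶠ y in u', ∀ᶠ x in u', P (y ++ x)) ∧ (∀ᶠ y in w', ∀ᶠ x in u', P (y ++ x)) ∧
        ∀ᶠ y in u', ∀ᶠ x in w', P (y ++ x) := by
    intro P hP
    refine ⟨em u u P ?_, em w u P ?_, em u w P ?_⟩
    · rwa [huu]
    · rwa [hwu]
    · rwa [huw]
  have ew : ∀ P : List (Option α) → Prop, (∀ᶠ x in w', P x) →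
      ∀ᶠ y in w', ∀ᶠ x in w', P (y ++ x) := by
    intro P hP
    refine em w w P ?_
    rwa [hww]
  have es : ∀ (P : List (Option α) → Prop) (a : α), (∀ᶠ x in w', P x) →
      ∀ᶠ y in u', P (subst (some a) y) := by
    intro P a hP
    have h1 : ∀ᶠ x in (w : Filter (FreeMonoid (Option α))), P x.toList := hP
    rw [← hsub a] at h1
    exact h1
  refine ⟨{p | (∀ᶠ x in u', p ++ x ∈ A) ∧ (none ∈ p → p ∈ A ∧ ∀ᶠ x in w', p ++ x ∈ A)},
    ⟨hA, by simp⟩, Or.inl fun p hp hn => (hp.2 hn).1, fun F hF hFf => ?_⟩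
  suffices h : ∀ᶠ y in u', none ∈ y ∧ ∀ p ∈ F, ∀ b, p ++ subst b y ∈
      {p | (∀ᶠ x in u', p ++ x ∈ A) ∧ (none ∈ p → p ∈ A ∧ ∀ᶠ x in w', p ++ x ∈ A)} by
    have : u'.NeBot := (u.map FreeMonoid.toList).neBot
    exact h.exists
  refine Eventually.and huV ((eventually_all_finite hFf).2 fun p hp => eventually_all.2 fun b => ?_)
  obtain ⟨hp1, hp2⟩ := hF hp
  obtain ⟨h1, h2, h3⟩ := eu _ hp1
  cases b with
  | none =>
    filter_upwards [h1, h3, hp1] with y hy1 hy2 hy3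
    rw [subst_none]
    simp only [List.append_assoc]
    exact ⟨hy1, fun _ => ⟨hy3, hy2⟩⟩
  | some a =>
    have hn : ∀ y, none ∈ p ++ subst (some a) y → none ∈ p := fun y hy =>
      (List.mem_append.1 hy).resolve_right (none_notMem_subst a y)
    by_cases hnp : none ∈ p
    · filter_upwards [es _ a h2, es _ a (hp2 hnp).2, es _ a (ew _ (hp2 hnp).2)] with y hy1 hy2 hy3
      simp only [List.append_assoc]
      exact ⟨hy1, fun _ => ⟨hy2, hy3⟩⟩
    · filter_upwards [es _ a h2] with y hy1
      simp only [List.append_assoc]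
      exact ⟨hy1, fun h => absurd (hn y h) hnp⟩

/-- A word has at least two constant letters. -/
def TwoConstants (y : List (Option α)) : Prop :=
  ∃ k l : ℕ, k < l ∧ (∃ a, y[k]? = some (some a)) ∧ ∃ a, y[l]? = some (some a)

/-- The words are chosen recursively so that all finitely many words extracted from the first `k` of
them stay good. -/
theorem exists_carlson [Finite α] [Nonempty α] (A : Set (List (Option α))) :
    ∃ y : ℕ → List (Option α), (∀ i, none ∈ y i ∧ TwoConstants (y i)) ∧
      ((∀ v, none ∈ v → extract y v ∈ A) ∨ ∀ v, none ∈ v → extract y v ∉ A) := by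
  obtain ⟨G, hG1, hG2, hG3⟩ := exists_good_words A
  obtain ⟨c⟩ := ‹Nonempty α›
  have step : ∀ F : {F : Set (List (Option α)) // F ⊆ G ∧ F.Finite}, ∃ y,
      (none ∈ y ∧ TwoConstants y) ∧ ∀ p ∈ F.1, ∀ b, p ++ subst b y ∈ G := by
    rintro ⟨F, hFG, hFf⟩
    obtain ⟨y₁, hn₁, hy₁⟩ := hG3 F hFG hFf
    obtain ⟨y₂, hn₂, hy₂⟩ := hG3 ((fun p => p ++ subst (some c) y₁) '' F)
      (Set.image_subset_iff.2 fun p hp => hy₁ p hp _) (hFf.image _)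
    obtain ⟨y₃, hn₃, hy₃⟩ := hG3
      ((fun p => p ++ subst (some c) y₂) '' ((fun p => p ++ subst (some c) y₁) '' F))
      (Set.image_subset_iff.2 fun p hp => hy₂ p hp _) ((hFf.image _).image _)
    have hss : ∀ b (y : List (Option α)), subst b (subst (some c) y) = subst (some c) y := by
      intro b y
      simp [subst]
    have hl₁ := List.length_pos_of_mem hn₁
    have hl₂ := List.length_pos_of_mem hn₂
    have hget : ∀ (y : List (Option α)), 0 < y.length →
        ∃ a, (subst (some c) y)[0]? = some (some a) := by
      intro y hy
      exact ⟨y[0].getD c, by simp [subst, hy]⟩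
    -- The first two segments are constant and nonempty; they supply the two constant letters.
    refine ⟨subst (some c) y₁ ++ (subst (some c) y₂ ++ y₃), ⟨by simp [hn₃],
      0, y₁.length, hl₁, ?_, ?_⟩, ?_⟩
    · rw [List.getElem?_append_left (by rwa [length_subst])]
      exact hget y₁ hl₁
    · rw [List.getElem?_append_right (by rw [length_subst]), length_subst, Nat.sub_self,
        List.getElem?_append_left (by rwa [length_subst])]
      exact hget y₂ hl₂
    · intro p hp b
      rw [subst_append, subst_append, hss, hss, ← List.append_assoc, ← List.append_assoc]
      exact hy₃ _ ⟨_, ⟨p, hp, rfl⟩, rfl⟩ b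
  choose Y hY1 hY2 using step
  let next : {F : Set (List (Option α)) // F ⊆ G ∧ F.Finite} →
      {F : Set (List (Option α)) // F ⊆ G ∧ F.Finite} := fun F =>
    ⟨Set.image2 (fun p b => p ++ subst b (Y F)) F.1 Set.univ, by
      rintro _ ⟨p, hp, b, -, rfl⟩
      exact hY2 F p hp b, F.2.2.image2 _ Set.finite_univ⟩
  let F : ℕ → {F : Set (List (Option α)) // F ⊆ G ∧ F.Finite} := fun k =>
    Nat.rec ⟨{[]}, by simpa using hG1, Set.finite_singleton _⟩ (fun _ => next) k
  have hmem : ∀ v, extract (fun k => Y (F k)) v ∈ (F v.length).1 := by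
    intro v
    induction v using List.reverseRecOn with
    | nil => exact Set.mem_singleton _
    | append_singleton v b ih =>
      rw [extract_concat, List.length_append, List.length_singleton]
      exact ⟨_, ih, b, Set.mem_univ _, rfl⟩
  have hvar : ∀ v, none ∈ v → none ∈ extract (fun k => Y (F k)) v := by
    intro v
    induction v using List.reverseRecOn with
    | nil => simp
    | append_singleton v b ih =>
      intro hv
      rw [extract_concat]
      rcases List.mem_append.1 hv with h | h
      · exact List.mem_append_left _ (ih h)
      · rw [← List.mem_singleton.1 h, subst_none]
        exact List.mem_append_right _ (hY1 _).1
  exact ⟨fun k => Y (F k), fun k => hY1 _, hG2.imp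
    (fun h v hv => h _ ((F v.length).2.1 (hmem v)) (hvar v hv))
    (fun h v hv => h _ ((F v.length).2.1 (hmem v)) (hvar v hv))⟩

end Carlson

end TRS

namespace TRS

/-! ### The creatures in `K_N` -/

section Space

variable {N : ℕ}

theorem KN.phi_eq_none {t : CreatureN N} (ht : t ∈ KN N) {p : ℕ} (hp : p ∉ t.block) :
    CreatureN.phi t p = none := by
  by_contra h
  have : p ∈ (CreatureN.phi t).dom := h
  rw [ht.2.1] at this
  exact hp (ht.1.1 this)

theorem KN.exists_phi_eq_none {t : CreatureN N} (ht : t ∈ KN N) :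
    ∃ p ∈ t.block, CreatureN.phi t p = none := by
  obtain ⟨p, hp, hpX⟩ := Set.exists_of_ssubset ht.1
  refine ⟨p, hp, ?_⟩
  by_contra h
  have : p ∈ (CreatureN.phi t).dom := h
  rw [ht.2.1] at this
  exact hpX this

theorem KN.ext {t t' : CreatureN N} (ht : t ∈ KN N) (ht' : t' ∈ KN N) (hdn : t.mdn = t'.mdn)
    (hup : t.mup = t'.mup) (hphi : CreatureN.phi t = CreatureN.phi t') : t = t' := by
  have hX : CreatureN.X t = CreatureN.X t' := by rw [← ht.2.1, ← ht'.2.1, hphi]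
  have hb : t.block = t'.block := by simp [FPCreature.block, hdn, hup]
  refine FPCreature.ext ?_ ?_ (Prod.ext hX hphi) hdn hup
  · rw [ht.2.2.1, ht'.2.2.1, hup]
  · rw [ht.2.2.2, ht'.2.2.2, hX, hb, hphi]

theorem finite_dom_subset_Ico (m n : ℕ) :
    {f : PFn (fun _ => Fin N) | f.dom ⊆ Set.Ico m n}.Finite := by
  refine Set.Finite.of_injOn (f := fun f (i : Fin n) => f i) (t := Set.univ)
    (fun _ _ => Set.mem_univ _) ?_ Set.finite_univ
  intro f hf g hg hfg
  funext i
  by_cases hi : i < n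
  · exact congrFun hfg ⟨i, hi⟩
  · have h1 : ∀ f : PFn (fun _ => Fin N), f.dom ⊆ Set.Ico m n → f i = none := fun f hf => by
      by_contra h
      exact hi (hf h).2
    rw [h1 f hf, h1 g hg]

theorem KN.exists_mk (hN : 0 < N) (m n : ℕ) (f : PFn (fun _ => Fin N))
    (hf : f.dom ⊂ Set.Ico m n) :
    ∃ t ∈ KN N, t.mdn = m ∧ t.mup = n ∧ CreatureN.phi t = f := by
  classical
  obtain ⟨q, hq, -⟩ := Set.exists_of_ssubset hf
  refine ⟨{
    nor := n
    val := {g | g.dom = Set.Ico m n ∧ g.Extends f ∧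
      ∀ i ∈ Set.Ico m n \ f.dom, ∀ i' ∈ Set.Ico m n \ f.dom, g i = g i'}
    dis := (f.dom, f)
    mdn := m
    mup := n
    mdn_lt_mup := hq.1.trans_lt hq.2
    val_nonempty := ?_
    val_finite := (finite_dom_subset_Ico m n).subset fun g hg => hg.1.subset
    dom_nonempty := fun g hg => hg.1 ▸ ⟨q, hq⟩
    dom_subset := fun g hg => hg.1.subset }, ⟨hf, rfl, rfl, rfl⟩, rfl, rfl, rfl⟩
  refine ⟨fun i => if i ∈ Set.Ico m n then (f i).or (some ⟨0, hN⟩) else none, ?_, ?_, ?_⟩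
  · ext i
    by_cases hi : i ∈ Set.Ico m n <;> simp [PFn.dom, -Set.mem_Ico, hi]
  · intro i hi
    have hi' : f i ≠ none := hi
    obtain ⟨c, hc⟩ := Option.ne_none_iff_exists'.1 hi'
    simp only [if_pos (hf.1 hi), hc, Option.some_or]
  · rintro i ⟨hi, hi'⟩ j ⟨hj, hj'⟩
    have h1 : f i = none := not_not.1 hi'
    have h2 : f j = none := not_not.1 hj'
    simp only [if_pos hi, if_pos hj, h1, h2]

/-- `t` is composed of `s_a, …, s_{b-1}`: on the block of `s_i`, the function `φ_t` extends
`φ_{s_i}` by a constant or not at all. -/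
structure Comp (incl : Set ℕ → Set ℕ → Prop) (s : ℕ → CreatureN N) (a b : ℕ) (t : CreatureN N) :
    Prop where
  lt : a < b
  mem : t ∈ KN N
  mdn_eq : t.mdn = (s a).mdn
  mup_eq : t.mup = (s b).mdn
  coeff : ∀ i, a ≤ i → i < b → ∃ c : Option (Fin N),
    (∀ p ∈ (s i).block, CreatureN.phi t p = (CreatureN.phi (s i) p).or c) ∧
      (c ≠ none → incl (s i).block (CreatureN.phi t).dom)

theorem restrict_mem_val_iff {s t : CreatureN N} (hs : s ∈ KN N) :
    (CreatureN.phi t).restrict s.block ∈ s.val ↔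
      ∃ c : Fin N, ∀ p ∈ s.block, CreatureN.phi t p = (CreatureN.phi s p).or (some c) := by
  have hdom : ∀ p, p ∈ CreatureN.X s ↔ CreatureN.phi s p ≠ none := fun p => by
    rw [← hs.2.1]; rfl
  have hres : ∀ p ∈ s.block, (CreatureN.phi t).restrict s.block p = CreatureN.phi t p :=
    fun p hp => if_pos hp
  rw [hs.2.2.2]
  constructor
  · rintro ⟨h1, h2, h3⟩
    obtain ⟨q, hq, hq'⟩ := KN.exists_phi_eq_none hs
    have hqX : q ∉ CreatureN.X s := fun h => (hdom q).1 h hq'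
    have hqd : q ∈ ((CreatureN.phi t).restrict s.block).dom := h1.superset hq
    obtain ⟨c, hc⟩ := Option.ne_none_iff_exists'.1 (show _ ≠ none from hqd)
    refine ⟨c, fun p hp => ?_⟩
    by_cases hpX : p ∈ CreatureN.X s
    · rw [← hres p hp, h2 p (hs.2.1 ▸ hpX)]
      obtain ⟨d, hd⟩ := Option.ne_none_iff_exists'.1 ((hdom p).1 hpX)
      rw [hd, Option.some_or]
    · rw [← hres p hp, h3 p ⟨hp, hpX⟩ q ⟨hq, hqX⟩, hc, not_not.1 (mt (hdom p).2 hpX),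
        Option.none_or]
  · rintro ⟨c, hc⟩
    refine ⟨?_, ?_, ?_⟩
    · ext p
      by_cases hp : p ∈ s.block
      · simp [PFn.dom, hres p hp, hc p hp, hp]
      · simp [PFn.dom, PFn.restrict, hp]
    · intro p hp
      have hp' : CreatureN.phi s p ≠ none := hp
      have hpb : p ∈ s.block := hs.1.1 ((hdom p).2 hp')
      obtain ⟨d, hd⟩ := Option.ne_none_iff_exists'.1 hp'
      rw [hres p hpb, hc p hpb, hd, Option.some_or]
    · rintro p ⟨hp, hpX⟩ q ⟨hq, hqX⟩
      rw [hres p hp, hres q hq, hc p hp, hc q hq, not_not.1 (mt (hdom p).2 hpX),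
        not_not.1 (mt (hdom q).2 hqX)]

theorem inter_block_eq_iff {s t : CreatureN N} (hs : s ∈ KN N) (ht : t ∈ KN N) :
    (CreatureN.X t ∩ s.block = CreatureN.X s ∧
      (CreatureN.phi t).restrict s.block = CreatureN.phi s) ↔
      ∀ p ∈ s.block, CreatureN.phi t p = CreatureN.phi s p := by
  have hres : ∀ p ∈ s.block, (CreatureN.phi t).restrict s.block p = CreatureN.phi t p :=
    fun p hp => if_pos hp
  constructor
  · rintro ⟨-, h⟩ p hp
    rw [← hres p hp, h]
  · intro h
    constructor
    · rw [← hs.2.1, ← ht.2.1]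
      ext p
      by_cases hp : p ∈ s.block
      · simp [PFn.dom, h p hp, hp]
      · simp [PFn.dom, hp, KN.phi_eq_none hs hp]
    · funext p
      by_cases hp : p ∈ s.block
      · rw [hres p hp, h p hp]
      · rw [KN.phi_eq_none hs hp]
        exact if_neg hp

/-- Coefficient `none` is alternative (i) and `some c` is alternative (ii), because a function in
`val` is `φ` completed by a single constant. The inclusion of the `X`'s is then automatic. -/
theorem mem_SigmaN_iff {incl : Set ℕ → Set ℕ → Prop} (s : PCtt (KN N)) {a b : ℕ} (hab : a < b)
    (t : CreatureN N) :
    t ∈ SigmaN N incl _ (segment s.1 a (b - 1)) ↔ Comp incl s.1 a b t := by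
  have hlast : (segment s.1 a (b - 1) (Fin.last _)).mup = (s.1 b).mdn := by
    have h1 : a + (b - 1 - a) = b - 1 := by omega
    have h2 := s.2.2.1 (b - 1)
    rw [Nat.sub_add_cancel (by omega)] at h2
    simp only [segment, Fin.val_last, h1, h2]
  have hdom : ∀ {i}, CreatureN.X (s.1 i) ⊆ (s.1 i).block := fun {i} => (s.2.1 i).1.1
  constructor
  · rintro ⟨h1, h2, h3, h4, h5, h6, h7⟩
    refine ⟨hab, h1, h4, h5.trans hlast, fun i hai hib => ?_⟩
    have hi := h7 ⟨i - a, by omega⟩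
    simp only [segment, Nat.add_sub_cancel' hai] at hi
    rcases hi with hi | ⟨hi, hi'⟩
    · exact ⟨none, by simpa using (inter_block_eq_iff (s.2.1 i) h1).1 hi, by simp⟩
    · obtain ⟨c, hc⟩ := (restrict_mem_val_iff (s.2.1 i)).1 hi'
      exact ⟨some c, hc, fun _ => h1.2.1 ▸ hi⟩
  · intro h
    refine ⟨h.mem, fun l => s.2.1 _, fun l => s.2.2.1 _, h.mdn_eq, h.mup_eq.trans hlast.symm,
      ?_, ?_⟩
    · refine Set.iUnion_subset fun l p hp => ?_
      obtain ⟨c, hc, -⟩ := h.coeff (a + l) (by omega) (by omega)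
      have hpb := hdom hp
      have hp' : CreatureN.phi (s.1 (a + l)) p ≠ none := by
        have : p ∈ CreatureN.X (s.1 (a + l)) := hp
        rwa [← (s.2.1 _).2.1] at this
      rw [← h.mem.2.1]
      change CreatureN.phi t p ≠ none
      rw [hc p hpb]
      simp [hp']
    · intro l
      obtain ⟨c, hc, hc'⟩ := h.coeff (a + l) (by omega) (by omega)
      cases c with
      | none => exact Or.inl ((inter_block_eq_iff (s.2.1 _) h.mem).2 (by simpa using hc))
      | some c =>
        exact Or.inr ⟨h.mem.2.1 ▸ hc' (by simp), (restrict_mem_val_iff (s.2.1 _)).2 ⟨c, hc⟩⟩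

/-! ### Tight sequences -/

theorem PCtt.mdn_strictMono (s : PCtt (KN N)) : StrictMono fun n => (s.1 n).mdn :=
  strictMono_nat_of_lt_succ fun n => s.2.2.1 n ▸ (s.1 n).mdn_lt_mup

theorem PCtt.block_eq (s : PCtt (KN N)) (n : ℕ) :
    (s.1 n).block = Set.Ico (s.1 n).mdn (s.1 (n + 1)).mdn := by
  rw [FPCreature.block, s.2.2.1 n]

theorem PCtt.exists_mem_block (s : PCtt (KN N)) {a b p : ℕ} (ha : (s.1 a).mdn ≤ p)
    (hb : p < (s.1 b).mdn) : ∃ i, a ≤ i ∧ i < b ∧ p ∈ (s.1 i).block := by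
  induction b with
  | zero =>
    have : (s.1 0).mdn ≤ (s.1 a).mdn := s.mdn_strictMono.monotone (Nat.zero_le a)
    omega
  | succ b ih =>
    by_cases h : p < (s.1 b).mdn
    · obtain ⟨i, h1, h2, h3⟩ := ih h
      exact ⟨i, h1, by omega, h3⟩
    · refine ⟨b, ?_, by omega, ?_⟩
      · exact Nat.lt_succ_iff.1 (s.mdn_strictMono.lt_iff_lt.1 (ha.trans_lt hb))
      · rw [s.block_eq]
        exact ⟨not_lt.1 h, hb⟩

theorem PCtt.mem_Ico_of_mem_block (s : PCtt (KN N)) {i a b p : ℕ} (ha : a ≤ i) (hb : i < b)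
    (hp : p ∈ (s.1 i).block) : p ∈ Set.Ico (s.1 a).mdn (s.1 b).mdn := by
  rw [s.block_eq] at hp
  exact ⟨(s.mdn_strictMono.monotone ha).trans hp.1,
    hp.2.trans_le (s.mdn_strictMono.monotone (Nat.succ_le_of_lt hb))⟩

theorem PCtt.eq_of_mem_block (s : PCtt (KN N)) {i j p : ℕ} (hi : p ∈ (s.1 i).block)
    (hj : p ∈ (s.1 j).block) : i = j := by
  have key : ∀ {i j}, p ∈ (s.1 i).block → p ∈ (s.1 j).block → ¬ i < j := by
    intro i j hi hj hij
    have h1 := (s.mem_Ico_of_mem_block le_rfl hij hi).2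
    exact absurd hj.1 (not_le.2 h1)
  exact le_antisymm (not_lt.1 (key hj hi)) (not_lt.1 (key hi hj))

theorem PCtt.exists_mk {T : ℕ → CreatureN N} (hT : ∀ n, T n ∈ KN N)
    (hc : ∀ n, (T n).mup = (T (n + 1)).mdn) : ∃ t : PCtt (KN N), t.1 = T := by
  refine ⟨⟨T, hT, hc, ?_⟩, rfl⟩
  refine Filter.tendsto_atTop_mono (fun n => ?_) (tendsto_natCast_atTop_atTop (R := NNReal))
  rw [(hT n).2.2.1, Nat.cast_le]
  have hmono : StrictMono fun n => (T n).mup := strictMono_nat_of_lt_succ fun n => by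
    rw [hc n]
    exact (T (n + 1)).mdn_lt_mup
  exact hmono.le_apply

theorem PCtt.exists_glue (X : PCtt (KN N)) (d : ℕ) {T : ℕ → CreatureN N} (hT : ∀ n, T n ∈ KN N)
    (hc : ∀ n, (T n).mup = (T (n + 1)).mdn) (h0 : 0 < d → (T 0).mdn = (X.1 d).mdn) :
    ∃ Y : PCtt (KN N), (∀ i < d, Y.1 i = X.1 i) ∧ ∀ i, Y.1 (d + i) = T i := by
  obtain ⟨Y, hY⟩ := PCtt.exists_mk (T := fun i => if i < d then X.1 i else T (i - d))
    (fun n => by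
      split_ifs
      · exact X.2.1 n
      · exact hT _)
    (fun n => by
      rcases lt_trichotomy (n + 1) d with h | h | h
      · simp only [if_pos h, if_pos (show n < d by omega), X.2.2.1 n]
      · simp only [if_pos (show n < d by omega), h, lt_irrefl, if_false, Nat.sub_self,
          h0 (by omega), X.2.2.1 n]
      · simp only [if_neg (show ¬ n < d by omega), if_neg (show ¬ n + 1 < d by omega),
          hc, show n + 1 - d = n - d + 1 by omega])
  refine ⟨Y, fun i hi => ?_, fun i => ?_⟩
  · simp [hY, hi]
  · simp [hY]

/-! ### The ordering as a condition on single creatures -/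

variable {incl : Set ℕ → Set ℕ → Prop}

theorem le_iff_exists_strictMono (t s : PCtt (KN N)) :
    PCtt.le (SigmaN N incl) t s ↔
      ∃ j : ℕ → ℕ, StrictMono j ∧ ∀ n, Comp incl s.1 (j n) (j (n + 1)) (t.1 n) := by
  constructor
  · rintro ⟨j, hj, h⟩
    exact ⟨j, hj, fun n => (mem_SigmaN_iff s (hj n.lt_succ_self) _).1 (h n)⟩
  · rintro ⟨j, hj, h⟩
    exact ⟨j, hj, fun n => (mem_SigmaN_iff s (hj n.lt_succ_self) _).2 (h n)⟩

/-- Tightness makes the index ranges fit together: left endpoints are strictly increasing, so the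
end of one range must be the start of the next. -/
theorem le_iff_forall_comp (t s : PCtt (KN N)) :
    PCtt.le (SigmaN N incl) t s ↔ ∀ n, ∃ a b, Comp incl s.1 a b (t.1 n) := by
  rw [le_iff_exists_strictMono]
  constructor
  · rintro ⟨j, -, h⟩ n
    exact ⟨_, _, h n⟩
  · intro h
    choose a b hab using h
    have hb : ∀ n, b n = a (n + 1) := fun n => s.mdn_strictMono.injective <| by
      rw [← (hab n).mup_eq, ← (hab (n + 1)).mdn_eq, t.2.2.1 n]
    refine ⟨a, strictMono_nat_of_lt_succ fun n => hb n ▸ (hab n).lt, fun n => ?_⟩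
    rw [← hb n]
    exact hab n

theorem Comp.self (s : PCtt (KN N)) (i : ℕ) : Comp incl s.1 i (i + 1) (s.1 i) where
  lt := i.lt_succ_self
  mem := s.2.1 i
  mdn_eq := rfl
  mup_eq := s.2.2.1 i
  coeff := by
    intro k h1 h2
    obtain rfl : k = i := by omega
    exact ⟨none, by simp, by simp⟩

/-- The properties of an inclusion relation used below, common to `⊆` and `⊂`. -/
structure InclusionLike (incl : Set ℕ → Set ℕ → Prop) : Prop where
  of_ssubset : ∀ {A B}, A ⊂ B → incl A B
  mono : ∀ {A A' B B'}, A' ⊆ A → incl A B → B ⊆ B' → incl A' B'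

/-- Coefficients compose by `Option.or`: a constant substituted first is never overwritten. -/
theorem Comp.trans (hincl : InclusionLike incl) {s u : PCtt (KN N)} {j : ℕ → ℕ}
    (hj : StrictMono j) (hs : ∀ n, Comp incl u.1 (j n) (j (n + 1)) (s.1 n)) {a b : ℕ}
    {t : CreatureN N} (ht : Comp incl s.1 a b t) : Comp incl u.1 (j a) (j b) t where
  lt := hj ht.lt
  mem := ht.mem
  mdn_eq := ht.mdn_eq.trans (hs a).mdn_eq
  mup_eq := ht.mup_eq.trans (hs b).mdn_eq
  coeff := by
    intro k hak hkb
    have h1 : (s.1 a).mdn ≤ (u.1 k).mdn := (hs a).mdn_eq ▸ u.mdn_strictMono.monotone hak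
    have h2 : (u.1 k).mdn < (s.1 b).mdn := (hs b).mdn_eq ▸ u.mdn_strictMono hkb
    obtain ⟨i, hai, hib, hki⟩ := s.exists_mem_block h1 h2
    rw [s.block_eq, (hs i).mdn_eq, (hs (i + 1)).mdn_eq] at hki
    have hjk : j i ≤ k := u.mdn_strictMono.le_iff_le.1 hki.1
    have hkj : k < j (i + 1) := u.mdn_strictMono.lt_iff_lt.1 hki.2
    have hsub : (u.1 k).block ⊆ (s.1 i).block := fun p hp => by
      rw [s.block_eq, (hs i).mdn_eq, (hs (i + 1)).mdn_eq]
      exact u.mem_Ico_of_mem_block hjk hkj hp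
    obtain ⟨c, hc, hc'⟩ := (hs i).coeff k hjk hkj
    obtain ⟨d, hd, hd'⟩ := ht.coeff i hai hib
    refine ⟨c.or d, fun p hp => ?_, fun hcd => ?_⟩
    · rw [hd p (hsub hp), hc p hp, Option.or_assoc]
    · by_cases hdn : d = none
      · have hcn : c ≠ none := by simpa [hdn] using hcd
        refine hincl.mono subset_rfl (hc' hcn) fun p hp => ?_
        have hp' : CreatureN.phi (s.1 i) p ≠ none := hp
        have hpb : p ∈ (s.1 i).block := by
          by_contra h
          exact hp' (KN.phi_eq_none (s.2.1 i) h)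
        change CreatureN.phi t p ≠ none
        rw [hd p hpb]
        simp [hp']
      · exact hincl.mono hsub (hd' hdn) subset_rfl

theorem PCtt.le_refl (s : PCtt (KN N)) : PCtt.le (SigmaN N incl) s s :=
  (le_iff_forall_comp s s).2 fun n => ⟨n, n + 1, Comp.self s n⟩

theorem PCtt.le_trans (hincl : InclusionLike incl) (t s u : PCtt (KN N))
    (hts : PCtt.le (SigmaN N incl) t s) (hsu : PCtt.le (SigmaN N incl) s u) :
    PCtt.le (SigmaN N incl) t u := by
  obtain ⟨j, hj, hs⟩ := (le_iff_exists_strictMono s u).1 hsu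
  refine (le_iff_forall_comp t u).2 fun n => ?_
  obtain ⟨a, b, hab⟩ := (le_iff_forall_comp t s).1 hts n
  exact ⟨_, _, hab.trans hincl hj hs⟩

/-! ### Finite approximations -/

theorem PCtt.r_succ (t : PCtt (KN N)) (n : ℕ) : t.r (n + 1) = t.r n ++ [t.1 n] := by
  simp [PCtt.r, List.range_succ]

theorem PCtt.length_r (t : PCtt (KN N)) (n : ℕ) : (t.r n).length = n := by
  simp [PCtt.r]

theorem PCtt.r_eq_iff (t s : PCtt (KN N)) (n : ℕ) :
    t.r n = s.r n ↔ ∀ i < n, t.1 i = s.1 i := by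
  simp [PCtt.r]

/-- The end of the last creature of a finite sequence, `0` for the empty sequence. -/
def endPos (u : List (CreatureN N)) : ℕ := (u.getLast?.map FPCreature.mup).getD 0

theorem endPos_r_zero (t : PCtt (KN N)) : endPos (t.r 0) = 0 := rfl

theorem endPos_r_succ (t : PCtt (KN N)) (n : ℕ) : endPos (t.r (n + 1)) = (t.1 (n + 1)).mdn := by
  simp [endPos, PCtt.r_succ, t.2.2.1 n]

theorem endPos_r (t : PCtt (KN N)) {n : ℕ} (hn : 0 < n) : endPos (t.r n) = (t.1 n).mdn := by
  obtain ⟨m, rfl⟩ := Nat.exists_eq_succ_of_ne_zero hn.ne'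
  exact endPos_r_succ t m

theorem endPos_strictMono (t : PCtt (KN N)) : StrictMono fun n => endPos (t.r n) := by
  refine strictMono_nat_of_lt_succ fun n => ?_
  rw [endPos_r_succ]
  rcases n.eq_zero_or_pos with rfl | hn
  · rw [endPos_r_zero]
    exact (Nat.zero_le _).trans_lt (t.mdn_strictMono Nat.zero_lt_one)
  · rw [endPos_r t hn]
    exact t.mdn_strictMono n.lt_succ_self

theorem finite_setOf_mup_le (k : ℕ) : {t ∈ KN N | t.mup ≤ k}.Finite := by
  refine Set.Finite.of_injOn (f := fun t => (t.mdn, t.mup, CreatureN.phi t))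
    (t := Set.Iic k ×ˢ Set.Iic k ×ˢ {f | f.dom ⊆ Set.Ico 0 k}) ?_ ?_
    ((Set.finite_Iic k).prod ((Set.finite_Iic k).prod (finite_dom_subset_Ico 0 k)))
  · rintro t ⟨ht, htk⟩
    refine ⟨t.mdn_lt_mup.le.trans htk, htk, fun p hp => ?_⟩
    have hp' : p ∈ t.block := by
      by_contra h
      exact hp (KN.phi_eq_none ht h)
    exact ⟨Nat.zero_le p, hp'.2.trans_le htk⟩
  · rintro t ⟨ht, -⟩ t' ⟨ht', -⟩ h
    simp only [Prod.mk.injEq] at h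
    exact KN.ext ht ht' h.1 h.2.1 h.2.2

theorem finite_setOf_endPos_eq (k : ℕ) :
    {u : List (CreatureN N) | endPos u = k ∧ ∃ (t : PCtt (KN N)) (n : ℕ), t.r n = u}.Finite := by
  have := (finite_setOf_mup_le (N := N) k).to_subtype
  refine ((List.finite_length_le {t ∈ KN N | t.mup ≤ k} k).image (List.map Subtype.val)).subset ?_
  rintro u ⟨hu, t, n, rfl⟩
  have hlen : n ≤ k := hu ▸ (endPos_strictMono t).le_apply
  have hmem : ∀ x ∈ t.r n, x ∈ {t ∈ KN N | t.mup ≤ k} := by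
    intro x hx
    simp only [PCtt.r, List.mem_map, List.mem_range] at hx
    obtain ⟨i, hi, rfl⟩ := hx
    refine ⟨t.2.1 i, ?_⟩
    rw [t.2.2.1 i, ← endPos_r_succ, ← hu]
    exact (endPos_strictMono t).monotone hi
  refine ⟨(t.r n).attachWith _ hmem, ?_, List.attachWith_map_subtype_val hmem⟩
  change ((t.r n).attachWith _ hmem).length ≤ k
  rwa [List.length_attachWith, PCtt.length_r]

/-! ### Fusion and amalgamation -/

/-- The diagonal sequence works because the ordering is tested term by term, and each term of it is
also a term of arbitrarily late `Y k`. -/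
theorem exists_limit (n : ℕ) (Y : ℕ → PCtt (KN N)) (hincl : InclusionLike incl)
    (hY : ∀ k, PCtt.le (SigmaN N incl) (Y (k + 1)) (Y k) ∧
      (Y (k + 1)).r (n + k) = (Y k).r (n + k)) :
    ∃ Z : PCtt (KN N), ∀ k, PCtt.le (SigmaN N incl) Z (Y k) ∧ Z.r (n + k) = (Y k).r (n + k) := by
  have hle : ∀ k d, PCtt.le (SigmaN N incl) (Y (k + d)) (Y k) := by
    intro k d
    induction d with
    | zero => exact PCtt.le_refl _
    | succ d ih => exact PCtt.le_trans hincl _ _ _ (hY (k + d)).1 ih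
  have heq : ∀ k d i, i < n + k → (Y (k + d)).1 i = (Y k).1 i := by
    intro k d i hi
    induction d with
    | zero => rfl
    | succ d ih =>
      rw [← ih]
      exact (PCtt.r_eq_iff _ _ _).1 (hY (k + d)).2 i (by omega)
  have heq' : ∀ i k, i < n + k → (Y (i + 1)).1 i = (Y k).1 i := by
    intro i k hi
    rw [← heq (i + 1) k i (by omega), ← heq k (i + 1) i hi, Nat.add_comm]
  obtain ⟨Z, hZ⟩ := PCtt.exists_mk (T := fun i => (Y (i + 1)).1 i) (fun i => (Y (i + 1)).2.1 i)
    (fun i => by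
      rw [heq' i (i + 2) (by omega)]
      exact (Y (i + 2)).2.2.1 i)
  refine ⟨Z, fun k => ⟨(le_iff_forall_comp _ _).2 fun i => ?_, ?_⟩⟩
  · rw [hZ]
    simp only
    rw [heq' i (k + (i + 1)) (by omega)]
    exact (le_iff_forall_comp _ _).1 (hle k (i + 1)) i
  · rw [PCtt.r_eq_iff]
    intro i hi
    rw [hZ]
    exact heq' i k hi

/-- For `m > 0`, `X'` is the first `d` terms of `X` followed by the tail of `Z` from `m` on. Any `W`
in question begins with the first `m` terms of `Z`, and its later terms start too far right to use
anything but that tail. -/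
theorem exists_amalgam (hincl : InclusionLike incl) (X Y Z : PCtt (KN N)) (m d : ℕ)
    (hYX : PCtt.le (SigmaN N incl) Y X) (he : endPos (Y.r m) = endPos (X.r d))
    (hZY : PCtt.le (SigmaN N incl) Z Y) (hZm : Z.r m = Y.r m) :
    ∃ X' : PCtt (KN N), PCtt.le (SigmaN N incl) X' X ∧ X'.r d = X.r d ∧
      ∀ W, PCtt.le (SigmaN N incl) W X' → W.r m = Y.r m → PCtt.le (SigmaN N incl) W Z := by
  have hZX := PCtt.le_trans hincl _ _ _ hZY hYX
  rcases m.eq_zero_or_pos with rfl | hm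
  · have hd : d = 0 := (endPos_strictMono X).injective (a₁ := d) (a₂ := 0) he.symm
    subst hd
    exact ⟨Z, hZX, rfl, fun W h _ => h⟩
  have hd : 0 < d := by
    rcases d.eq_zero_or_pos with rfl | hd
    · have := endPos_strictMono Y hm
      simp only [he, endPos_r_zero, lt_irrefl] at this
    · exact hd
  have hmdn : ∀ W : PCtt (KN N), W.r m = Y.r m → (W.1 m).mdn = (X.1 d).mdn := by
    intro W hW
    rw [← endPos_r W hm, hW, he, endPos_r X hd]
  obtain ⟨X', hX'1, hX'2⟩ := X.exists_glue d (T := fun i => Z.1 (m + i)) (fun i => Z.2.1 _)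
    (fun i => Z.2.2.1 _) (fun _ => hmdn Z hZm)
  refine ⟨X', (le_iff_forall_comp _ _).2 fun i => ?_, (PCtt.r_eq_iff _ _ _).2 hX'1,
    fun W hWX' hW => (le_iff_forall_comp _ _).2 fun i => ?_⟩
  · rcases lt_or_ge i d with hi | hi
    · rw [hX'1 i hi]
      exact ⟨_, _, Comp.self X i⟩
    · obtain ⟨k, rfl⟩ := Nat.exists_eq_add_of_le hi
      rw [hX'2]
      exact (le_iff_forall_comp _ _).1 hZX _
  · rcases lt_or_ge i m with hi | hi
    · rw [(PCtt.r_eq_iff _ _ _).1 (hW.trans hZm.symm) i hi]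
      exact ⟨_, _, Comp.self Z i⟩
    · obtain ⟨a, b, hab⟩ := (le_iff_forall_comp _ _).1 hWX' i
      have hda : d ≤ a := by
        refine X'.mdn_strictMono.le_iff_le.1 ?_
        change (X'.1 d).mdn ≤ (X'.1 a).mdn
        rw [← hab.mdn_eq, show X'.1 d = Z.1 m from hX'2 0, hmdn Z hZm, ← hmdn W hW]
        exact W.mdn_strictMono.monotone hi
      obtain ⟨a, rfl⟩ := Nat.exists_eq_add_of_le hda
      obtain ⟨b, rfl⟩ := Nat.exists_eq_add_of_le (hda.trans hab.lt.le)
      refine ⟨m + a, m + b, Nat.add_lt_add_left (Nat.lt_of_add_lt_add_left hab.lt) m, hab.mem,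
        ?_, ?_, ?_⟩
      · rw [hab.mdn_eq, hX'2]
      · rw [hab.mup_eq, hX'2]
      · intro k hk1 hk2
        obtain ⟨k, rfl⟩ := Nat.exists_eq_add_of_le ((Nat.le_add_right m a).trans hk1)
        have := hab.coeff (d + k) (by omega) (by omega)
        rwa [hX'2] at this

/-! ### The pigeonhole principle -/

/-- On the blocks of `s_a, s_{a+1}, …` the function `f` is obtained from the functions `φ` by
substituting the letters of the word `w`. -/
def Represents (s : PCtt (KN N)) (a : ℕ) (w : List (Option (Fin N))) (f : PFn (fun _ => Fin N)) :
    Prop :=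
  ∀ k c, w[k]? = some c → ∀ p ∈ (s.1 (a + k)).block, f p = (CreatureN.phi (s.1 (a + k)) p).or c

/-- `t` is the creature obtained by substituting the word `w` into `s_a, s_{a+1}, …`. -/
structure IsWordCreature (s : PCtt (KN N)) (a : ℕ) (w : List (Option (Fin N))) (t : CreatureN N) :
    Prop where
  mem : t ∈ KN N
  mdn_eq : t.mdn = (s.1 a).mdn
  mup_eq : t.mup = (s.1 (a + w.length)).mdn
  represents : Represents s a w (CreatureN.phi t)

theorem Represents.append {s : PCtt (KN N)} {a : ℕ} {w w' : List (Option (Fin N))}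
    {f : PFn (fun _ => Fin N)} (h : Represents s a w f) (h' : Represents s (a + w.length) w' f) :
    Represents s a (w ++ w') f := by
  intro k c hk p hp
  rcases lt_or_ge k w.length with hlt | hge
  · rw [List.getElem?_append_left hlt] at hk
    exact h k c hk p hp
  · rw [List.getElem?_append_right hge] at hk
    have := h' _ c hk p
    rw [Nat.add_assoc, Nat.add_sub_cancel' hge] at this
    exact this hp

theorem IsWordCreature.unique {s : PCtt (KN N)} {a : ℕ} {w : List (Option (Fin N))}
    {t t' : CreatureN N} (h : IsWordCreature s a w t) (h' : IsWordCreature s a w t') : t = t' := by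
  have hdn := h.mdn_eq.trans h'.mdn_eq.symm
  have hup := h.mup_eq.trans h'.mup_eq.symm
  refine KN.ext h.mem h'.mem hdn hup (funext fun p => ?_)
  by_cases hp : p ∈ t.block
  · obtain ⟨i, hai, hib, hpi⟩ := s.exists_mem_block (h.mdn_eq ▸ hp.1) (h.mup_eq ▸ hp.2)
    obtain ⟨k, rfl⟩ := Nat.exists_eq_add_of_le hai
    have hk : k < w.length := by omega
    rw [h.represents k _ (List.getElem?_eq_getElem hk) p hpi,
      h'.represents k _ (List.getElem?_eq_getElem hk) p hpi]
  · have hp' : p ∉ t'.block := by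
      rwa [FPCreature.block, ← hdn, ← hup]
    rw [KN.phi_eq_none h.mem hp, KN.phi_eq_none h'.mem hp']

theorem exists_isWordCreature (hN : 0 < N) (s : PCtt (KN N)) (a : ℕ) (w : List (Option (Fin N)))
    (hw : none ∈ w) : ∃ t, IsWordCreature s a w t := by
  classical
  let Q : ℕ → ℕ × Option (Fin N) → Prop := fun p x =>
    w[x.1]? = some x.2 ∧ p ∈ (s.1 (a + x.1)).block
  let f : PFn (fun _ => Fin N) := fun p =>
    if h : ∃ x, Q p x then (CreatureN.phi (s.1 (a + h.choose.1)) p).or h.choose.2 else none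
  have hf : Represents s a w f := by
    intro k c hk p hp
    have h : ∃ x, Q p x := ⟨(k, c), hk, hp⟩
    have hk' : h.choose.1 = k := by
      have := s.eq_of_mem_block h.choose_spec.2 hp
      omega
    have hc' : h.choose.2 = c := by
      have := h.choose_spec.1
      rw [hk', hk] at this
      exact (Option.some.inj this).symm
    simp only [f, dif_pos h, hk', hc']
  obtain ⟨k, hk, hkn⟩ := List.getElem_of_mem hw
  have hkn' : w[k]? = some none := by rw [List.getElem?_eq_getElem hk, hkn]
  obtain ⟨q, hq, hqn⟩ := KN.exists_phi_eq_none (s.2.1 (a + k))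
  have hdom : f.dom ⊂ Set.Ico (s.1 a).mdn (s.1 (a + w.length)).mdn := by
    -- A variable letter leaves the undefined point `q` of its block undefined, so the domain is
    -- proper.
    refine (Set.ssubset_iff_of_subset ?_).2 ⟨q, s.mem_Ico_of_mem_block (Nat.le_add_right _ _)
      (Nat.add_lt_add_left hk a) hq, ?_⟩
    · intro p hp
      have h : ∃ x, Q p x := by
        by_contra h
        exact hp (dif_neg h)
      obtain ⟨⟨l, c⟩, hl, hpl⟩ := h
      exact s.mem_Ico_of_mem_block (Nat.le_add_right _ _)
        (Nat.add_lt_add_left (List.getElem?_eq_some_iff.1 hl).1 a) hpl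
    · simp only [PFn.dom, Set.mem_ofPred_eq, not_not]
      rw [hf k none hkn' q hq, hqn, Option.none_or]
  obtain ⟨t, ht, h1, h2, h3⟩ := KN.exists_mk hN _ _ f hdom
  exact ⟨t, ht, h1, h2, h3 ▸ hf⟩

/-- A second constant letter fills another block, so each substituted block is properly contained in
`X_t`. -/
theorem IsWordCreature.comp (hincl : InclusionLike incl) {s : PCtt (KN N)} {a : ℕ}
    {w : List (Option (Fin N))} {t : CreatureN N} (h : IsWordCreature s a w t)
    (hw : ∀ (k : ℕ) c, w[k]? = some (some c) → ∃ l ≠ k, ∃ d, w[l]? = some (some d)) :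
    Comp incl s.1 a (a + w.length) t where
  lt := by
    refine s.mdn_strictMono.lt_iff_lt.1 ?_
    change (s.1 a).mdn < (s.1 (a + w.length)).mdn
    rw [← h.mdn_eq, ← h.mup_eq]
    exact t.mdn_lt_mup
  mem := h.mem
  mdn_eq := h.mdn_eq
  mup_eq := h.mup_eq
  coeff := by
    intro i hai hib
    obtain ⟨k, rfl⟩ := Nat.exists_eq_add_of_le hai
    have hk := List.getElem?_eq_getElem (show k < w.length by omega)
    refine ⟨_, h.represents k _ hk, fun hne => ?_⟩
    have hsub : ∀ l d, w[l]? = some (some d) →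
        (s.1 (a + l)).block ⊆ (CreatureN.phi t).dom := by
      intro l d hl p hp
      change CreatureN.phi t p ≠ none
      rw [h.represents l _ hl p hp]
      simp
    obtain ⟨c, hc⟩ := Option.ne_none_iff_exists'.1 hne
    rw [hc] at hk
    obtain ⟨l, hlk, d, hl⟩ := hw k c hk
    refine hincl.of_ssubset ((Set.ssubset_iff_of_subset (hsub k c hk)).2 ?_)
    have hmem : (s.1 (a + l)).mdn ∈ (s.1 (a + l)).block := ⟨le_rfl, (s.1 (a + l)).mdn_lt_mup⟩
    refine ⟨_, hsub l d hl hmem, fun h' => hlk ?_⟩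
    have := s.eq_of_mem_block hmem h'
    omega

theorem exists_coarsening (hN : 0 < N) (hincl : InclusionLike incl) (s : PCtt (KN N)) {g : ℕ → ℕ}
    (hg : StrictMono g) :
    ∃ t : PCtt (KN N), ∀ i, Comp incl s.1 (g i) (g (i + 1)) (t.1 i) := by
  have hw : ∀ i, ∃ t, Comp incl s.1 (g i) (g (i + 1)) t := by
    intro i
    have hi : g i < g (i + 1) := hg i.lt_succ_self
    obtain ⟨t, ht⟩ := exists_isWordCreature hN s (g i) (List.replicate (g (i + 1) - g i) none)
      (List.mem_replicate.2 ⟨by omega, rfl⟩)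
    have := ht.comp hincl (by simp [List.getElem?_replicate])
    rw [List.length_replicate, Nat.add_sub_cancel' hi.le] at this
    exact ⟨t, this⟩
  choose T hT using hw
  obtain ⟨t, rfl⟩ := PCtt.exists_mk (fun i => (hT i).mem)
    (fun i => (hT i).mup_eq.trans (hT (i + 1)).mdn_eq.symm)
  exact ⟨t, hT⟩

theorem Represents.subst {s : PCtt (KN N)} {a : ℕ} {w : List (Option (Fin N))} {t : CreatureN N}
    (h : IsWordCreature s a w t) {f : PFn (fun _ => Fin N)} {c : Option (Fin N)}
    (hf : ∀ p ∈ t.block, f p = (CreatureN.phi t p).or c) : Represents s a (subst c w) f := by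
  intro k d hk p hp
  simp only [TRS.subst, List.getElem?_map, Option.map_eq_some_iff] at hk
  obtain ⟨d, hd, rfl⟩ := hk
  have hpt : p ∈ t.block := by
    rw [FPCreature.block, h.mdn_eq, h.mup_eq]
    exact s.mem_Ico_of_mem_block (Nat.le_add_right _ _)
      (Nat.add_lt_add_left (List.getElem?_eq_some_iff.1 hd).1 a) hp
  rw [hf p hpt, h.represents k d hd p hp, Option.or_assoc]

/-- Carlson's theorem is applied to the variable words coding creatures in `C`. The tail of `X` is
replaced by the creatures coded by `y 0, y 1, …`; a composition of these starting at `n` is coded by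
an extracted word. -/
theorem exists_homogeneous (hN : 0 < N) (hincl : InclusionLike incl) (X : PCtt (KN N)) (n : ℕ)
    (C : Set (CreatureN N)) :
    ∃ Y : PCtt (KN N), PCtt.le (SigmaN N incl) Y X ∧ Y.r n = X.r n ∧
      ((∀ b t, Comp incl Y.1 n b t → t ∈ C) ∨ ∀ b t, Comp incl Y.1 n b t → t ∉ C) := by
  have : Nonempty (Fin N) := ⟨⟨0, hN⟩⟩
  obtain ⟨y, hy, hyC⟩ := exists_carlson {w | ∃ t ∈ C, IsWordCreature X n w t}
  -- The index in `X` at which the word `y i` begins.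
  let pos : ℕ → ℕ := fun i => n + ∑ k ∈ Finset.range i, (y k).length
  have hpos : ∀ i, pos (i + 1) = pos i + (y i).length := fun i => by
    simp only [pos, Finset.sum_range_succ, Nat.add_assoc]
  choose D hD using fun i => exists_isWordCreature hN X (pos i) (y i) (hy i).1
  obtain ⟨Y, hY1, hY2⟩ := X.exists_glue n (T := D) (fun i => (hD i).mem)
    (fun i => by rw [(hD i).mup_eq, (hD (i + 1)).mdn_eq, hpos])
    (fun _ => (hD 0).mdn_eq)
  refine ⟨Y, (le_iff_forall_comp _ _).2 fun i => ?_, (PCtt.r_eq_iff _ _ _).2 hY1, ?_⟩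
  · rcases lt_or_ge i n with hi | hi
    · rw [hY1 i hi]
      exact ⟨_, _, Comp.self X i⟩
    · obtain ⟨k, rfl⟩ := Nat.exists_eq_add_of_le hi
      rw [hY2]
      refine ⟨_, _, (hD k).comp hincl fun i c _ => ?_⟩
      obtain ⟨l, l', hll', hl, hl'⟩ := (hy k).2
      rcases eq_or_ne l i with rfl | hne
      · exact ⟨l', hll'.ne', hl'⟩
      · exact ⟨l, hne, hl⟩
  have key : ∀ b t, Comp incl Y.1 n b t → ∃ v, none ∈ v ∧ IsWordCreature X n (extract y v) t := by
    intro b t ht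
    obtain ⟨b, rfl⟩ := Nat.exists_eq_add_of_le ht.lt.le
    have hc : ∀ i, ∃ c : Option (Fin N), i < b →
        ∀ p ∈ (D i).block, CreatureN.phi t p = (CreatureN.phi (D i) p).or c := by
      intro i
      by_cases hi : i < b
      · obtain ⟨c, hc, -⟩ := ht.coeff (n + i) (by omega) (by omega)
        rw [hY2] at hc
        exact ⟨c, fun _ => hc⟩
      · exact ⟨none, fun h => absurd h hi⟩
    choose c hc using hc
    have hrep : ∀ k ≤ b, n + (extract y ((List.range k).map c)).length = pos k ∧
        Represents X n (extract y ((List.range k).map c)) (CreatureN.phi t) := by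
      intro k hk
      induction k with
      | zero => exact ⟨by simp [pos, extract_nil], fun k c hk => by simp [extract_nil] at hk⟩
      | succ k ih =>
        obtain ⟨h1, h2⟩ := ih (by omega)
        rw [List.range_succ, List.map_append, List.map_singleton, extract_concat,
          List.length_map, List.length_range]
        refine ⟨by rw [List.length_append, length_subst, ← Nat.add_assoc, h1, hpos],
          h2.append ?_⟩
        rw [h1]
        exact Represents.subst (hD k) (hc k (by omega))
    obtain ⟨h1, h2⟩ := hrep b le_rfl
    refine ⟨(List.range b).map c, ?_, ht.mem, ?_, ?_, h2⟩
    -- A point where `φ_t` is undefined forces the coefficient of its block to be `none`.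
    · obtain ⟨p, hp, hpn⟩ := KN.exists_phi_eq_none ht.mem
      obtain ⟨i, hni, hib, hpi⟩ := Y.exists_mem_block (ht.mdn_eq ▸ hp.1) (ht.mup_eq ▸ hp.2)
      obtain ⟨i, rfl⟩ := Nat.exists_eq_add_of_le hni
      have hib' : i < b := by omega
      rw [hY2] at hpi
      have h3 := hc i hib' p hpi
      rw [hpn] at h3
      exact List.mem_map.2 ⟨i, List.mem_range.2 hib', (Option.or_eq_none_iff.1 h3.symm).2⟩
    · rw [ht.mdn_eq, show Y.1 n = D 0 from hY2 0, (hD 0).mdn_eq]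
      rfl
    · rw [ht.mup_eq, hY2, (hD b).mdn_eq, h1]
  refine hyC.imp (fun h b t ht => ?_) fun h b t ht htC => ?_
  · obtain ⟨v, hv, hvt⟩ := key b t ht
    obtain ⟨t', ht', hvt'⟩ := h v hv
    rwa [hvt.unique hvt']
  · obtain ⟨v, hv, hvt⟩ := key b t ht
    exact h v hv ⟨t, htC, hvt⟩

/-- Fusion over all starting indices gives each index `k` a colour. One colour occurs infinitely
often, and coarsening along those indices makes every composition start at one of them. -/
theorem exists_homogeneous_all (hN : 0 < N) (hincl : InclusionLike incl) (X : PCtt (KN N))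
    (C : Set (CreatureN N)) :
    ∃ Y : PCtt (KN N), PCtt.le (SigmaN N incl) Y X ∧
      ((∀ a b t, Comp incl Y.1 a b t → t ∈ C) ∨ ∀ a b t, Comp incl Y.1 a b t → t ∉ C) := by
  choose F hF1 hF2 hF3 using fun k (Y : PCtt (KN N)) => exists_homogeneous hN hincl Y k C
  let Y : ℕ → PCtt (KN N) := fun k => Nat.rec X F k
  obtain ⟨L, hL⟩ := exists_limit (incl := incl) 0 Y hincl
    (fun k => ⟨hF1 k (Y k), by rw [Nat.zero_add]; exact hF2 k (Y k)⟩)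
  have hcomp : ∀ k b t, Comp incl L.1 k b t → ∃ b', Comp incl (Y (k + 1)).1 k b' t := by
    intro k b t ht
    obtain ⟨j, hj, hjc⟩ := (le_iff_exists_strictMono _ _).1 (hL (k + 1)).1
    -- Term `k` is already frozen in `Y (k + 1)`, so compositions starting at `k` still start at `k`
    -- there.
    have hjk : j k = k := (Y (k + 1)).mdn_strictMono.injective <| by
      rw [← (hjc k).mdn_eq, (PCtt.r_eq_iff _ _ _).1 (hL (k + 1)).2 k (by omega)]
    have := ht.trans hincl hj hjc
    rw [hjk] at this
    exact ⟨_, this⟩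
  have hcol : ∀ k, (∀ b t, Comp incl L.1 k b t → t ∈ C) ∨ ∀ b t, Comp incl L.1 k b t → t ∉ C := by
    intro k
    refine (hF3 k (Y k)).imp (fun h b t ht => ?_) fun h b t ht => ?_ <;>
    · obtain ⟨b', hb'⟩ := hcomp k b t ht
      exact h b' t hb'
  have hfin : ∀ p : ℕ → Prop, {k | p k}.Infinite → ∃ T : PCtt (KN N),
      PCtt.le (SigmaN N incl) T X ∧ ∀ a b t, Comp incl T.1 a b t →
        ∃ k b', p k ∧ Comp incl L.1 k b' t := by
    intro p hp
    obtain ⟨T, hT⟩ := exists_coarsening hN hincl L (Nat.nth_strictMono hp)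
    refine ⟨T, PCtt.le_trans hincl _ _ _ ((le_iff_forall_comp _ _).2 fun i => ⟨_, _, hT i⟩)
      (hL 0).1, fun a b t ht => ?_⟩
    exact ⟨_, _, Nat.nth_mem_of_infinite hp a, ht.trans hincl (Nat.nth_strictMono hp) hT⟩
  by_cases hinf : {k | ∀ b t, Comp incl L.1 k b t → t ∈ C}.Infinite
  · obtain ⟨T, hTX, hT⟩ := hfin _ hinf
    refine ⟨T, hTX, Or.inl fun a b t ht => ?_⟩
    obtain ⟨k, b', hk, hb'⟩ := hT a b t ht
    exact hk b' t hb'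
  · obtain ⟨T, hTX, hT⟩ := hfin (fun k => ∀ b t, Comp incl L.1 k b t → t ∉ C)
      ((Set.not_infinite.1 hinf).infinite_compl.mono fun k hk => (hcol k).resolve_left hk)
    refine ⟨T, hTX, Or.inr fun a b t ht => ?_⟩
    obtain ⟨k, b', hk, hb'⟩ := hT a b t ht
    exact hk b' t hb'

/-- For `n > 0` the next creature must start where the approximation ends. For `n = 0` initial
creatures may be dropped, so all starting indices have to be made homogeneous at once. -/
theorem exists_pigeonhole (hN : 0 < N) (hincl : InclusionLike incl) (X : PCtt (KN N)) (n : ℕ)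
    (O : Set (List (CreatureN N))) :
    ∃ Y : PCtt (KN N), PCtt.le (SigmaN N incl) Y X ∧ Y.r n = X.r n ∧
      ((∀ Z, PCtt.le (SigmaN N incl) Z Y → Z.r n = X.r n → Z.r (n + 1) ∈ O) ∨
        ∀ Z, PCtt.le (SigmaN N incl) Z Y → Z.r n = X.r n → Z.r (n + 1) ∉ O) := by
  rcases n.eq_zero_or_pos with rfl | hn
  · obtain ⟨Y, hYX, hY⟩ := exists_homogeneous_all hN hincl X {t | [t] ∈ O}
    refine ⟨Y, hYX, rfl, hY.imp (fun h Z hZ _ => ?_) fun h Z hZ _ => ?_⟩ <;>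
    · obtain ⟨a, b, hab⟩ := (le_iff_forall_comp _ _).1 hZ 0
      exact h a b _ hab
  · obtain ⟨Y, hYX, hYn, hY⟩ := exists_homogeneous hN hincl X n {t | X.r n ++ [t] ∈ O}
    refine ⟨Y, hYX, hYn, hY.imp (fun h Z hZ hZn => ?_) fun h Z hZ hZn => ?_⟩ <;>
    · obtain ⟨a, b, hab⟩ := (le_iff_forall_comp _ _).1 hZ n
      have ha : a = n := Y.mdn_strictMono.injective <| by
        rw [← hab.mdn_eq, ← endPos_r Z hn, ← endPos_r Y hn, hZn, hYn]
      subst ha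
      rw [PCtt.r_succ, hZn]
      exact h b _ hab

/-! ### Verification of the abstract conditions -/

theorem nonempty_PCtt (hN : 0 < N) : Nonempty (PCtt (KN N)) := by
  choose T hT1 hT2 hT3 _ using fun n => KN.exists_mk hN n (n + 1) (fun _ => none) (by
    refine (Set.ssubset_iff_of_subset fun p hp => absurd rfl hp).2 ⟨n, ⟨le_rfl, n.lt_succ_self⟩, ?_⟩
    exact fun h => h rfl)
  obtain ⟨t, -⟩ := PCtt.exists_mk hT1 fun n => (hT3 n).trans (hT2 (n + 1)).symm
  exact ⟨t⟩

theorem ellentuckConditions (hN : 0 < N) (hincl : InclusionLike incl) :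
    EllentuckConditions (PCtt.le (K := KN N) (SigmaN N incl)) PCtt.r endPos where
  nonempty := nonempty_PCtt hN
  refl := PCtt.le_refl
  trans := PCtt.le_trans hincl
  length_eq X Y m n h := by rw [← X.length_r m, h, Y.length_r]
  restrict X Y m n hmn h := (PCtt.r_eq_iff _ _ _).2 fun i hi =>
    (PCtt.r_eq_iff _ _ _).1 h i (hi.trans_le hmn)
  strictMono := endPos_strictMono
  depth X Y hYX m := by
    cases m with
    | zero => exact ⟨0, rfl⟩
    | succ m =>
      obtain ⟨a, b, hab⟩ := (le_iff_forall_comp _ _).1 hYX m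
      refine ⟨b, ?_⟩
      rw [endPos_r_succ, endPos_r X ((Nat.zero_le a).trans_lt hab.lt), ← hab.mup_eq, Y.2.2.1 m]
  finite := finite_setOf_endPos_eq
  limit n Y hY := exists_limit n Y hincl hY
  amalgamation := exists_amalgam hincl
  pigeonhole := exists_pigeonhole hN hincl

theorem inclusionLike_subset : InclusionLike fun A B => A ⊆ B where
  of_ssubset h := h.subset
  mono h1 h2 h3 := h1.trans (h2.trans h3)

theorem inclusionLike_ssubset : InclusionLike fun A B => A ⊂ B where
  of_ssubset h := h
  mono h1 h2 h3 := (h1.trans_ssubset h2).trans_subset h3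

end Space

end TRS

theorem theorem4p8 (N : ℕ) (hN : 0 < N) :
    TRS.IsTopologicalRamseySpace
      (TRS.PCtt.le (K := TRS.KN N) (TRS.SigmaN N (fun A B => A ⊆ B))) TRS.PCtt.r ∧
    TRS.IsTopologicalRamseySpace
      (TRS.PCtt.le (K := TRS.KN N) (TRS.SigmaN N (fun A B => A ⊂ B))) TRS.PCtt.r :=
  ⟨(TRS.ellentuckConditions hN TRS.inclusionLike_subset).isTopologicalRamseySpace,
    (TRS.ellentuckConditions hN TRS.inclusionLike_ssubset).isTopologicalRamseySpace⟩
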